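/- Let $H:\mathbb R\to[0,1]$ be a low pass filter, i.e. $H$ is infinitely differentiable and even, $H(t)=1$ for $|t|\le 1/2$, and $H(t)=0$ for $|t|\ge 1$. Put $\hbar_n=\bigl(\sum_{|\ell|<n}H(|\ell|/n)\bigr)^{-1}$ and, for $F:\mathbb R\to\mathbb C$, $R>0$, $t^*\in\mathbb R$, $$\mathcal T_{n,R}(F)(t^*;x)=\hbar_n\sum_{|\ell|<n}H(|\ell|/n)\,F(t^*-\ell/R)\,e^{i\ell x},\qquad x\in\mathbb T=\mathbb R/2\pi\mathbb Z .$$ For $x,y\in\mathbb T$ let $|x-y|$ denote the distance on $\mathbb T$, that is, $\min_{k\in\mathbb Z}|x-y-2\pi k|$. A mean zero real random variable $X$ is in $\mathcal G(\nu)$ if $\log\mathbb E\,e^{sX}\le (s\nu)^2/2$ for all $s\in\mathbb R$; a complex random variable is in $\mathcal G(\nu)$ if its real and imaginary parts are. **Theorem.** There are positive constants $C_1\ge 1$, $C_2$, $C_3$ depending only on $H$ such that the following holds. Let $S\ge 2$ and $K\ge 1$ be integers, $0<\delta<1$, $t^*\in\mathbb R$, $\alpha,\Delta,R>0$, $V\ge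 0$, and let $n=\lfloor R\Delta\rfloor$. For $j=1,\dots,K$ let $A_j$ (complex valued) be continuous and $\phi_j$ (real valued) be continuously differentiable on $[t^*-\Delta,t^*+\Delta]$, with $$|A_j(t^*+u)-A_j(t^*)|\le\alpha|u|\,|A_j(t^*)|,\qquad |\phi_j'(t^*+u)-\phi_j'(t^*)|\le\alpha|u|\,|\phi_j'(t^*)|,\qquad |u|\le\Delta .$$ Let $f_j=A_je^{i\phi_j}$ and $F(t)=\sum_{j=1}^K f_j(t)+\epsilon(t)$, where each $\epsilon(t)$ is a complex random variable in $\mathcal G(V)$ and the samples $\epsilon(t^*-\ell/R)$, $|\ell|<n$, are independent. Write $$\mathbf M=\sum_j|A_j(t^*)|,\quad B=\max_j|\phi_j'(t^*)|,\quad \mathfrak m=\min_j|f_j(t^*)|,\quad \lambda_j=\phi_j'(t^*)/R \in\mathbb T,\quad \eta^*=\min_{j\ne k}|\lambda_j-\lambda_k|$$ ($\eta^*=\infty$ if $K=1$), and $$L=\frac{14\sqrt{2\pi}}{3}\,\frac{\|H^{(S)}\|_1}{\|H\|_1},\qquad C=\max\Bigl(1,\Bigl(\frac{16\,\mathbf M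 L}{\mathfrak m}\Bigr)^{1/S}\Bigr).$$ Assume that $\mathfrak m>0$, $\eta^*>0$, and $$n\ge C_1,\qquad C_2V\sqrt{\frac{\log(C_3n/\delta)}{n}}\le\frac{\mathfrak m}{16},\qquad n\ge\frac{4C}{\eta^*},\qquad \alpha\mathbf M(B\Delta+1)\Delta\le\frac{\mathfrak m}{4}.$$ Let $\mathbb G=\{x\in\mathbb T:|\mathcal T_{n,R}(F)(t^*;x)|\ge 3\mathfrak m/4\}$. Then with probability exceeding $1-\delta$ all of the following hold: * $\mathbb G$ is a disjoint union of $K$ sets $\mathbb G_1,\dots,\mathbb G_K$; * $\operatorname{diam}(\mathbb G_\ell)\le 2C/n$ for each $\ell$; * $\operatorname{dist}(\mathbb G_\ell,\mathbb G_k)\ge\eta^*/2$ for $\ell\ne k$; * $\{x\in\mathbb T:|x-\lambda_\ell|\le 1/(4n)\}\subseteq\mathbb G_\ell$ for each $\ell$ (in particular $\mathbb G_\ell\neq\emptyset$); * for each $\ell$ the function $|\mathcal T_{n,R}(F)(t^*;\cdot)|$ attains its maximum over $\mathbb G_\ell$, and every maximizer $\hat\lambda_\ell\in\mathbb G_\ell$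 satisfies $|\hat\lambda_\ell-\lambda_\ell|\le 2C/n$; consequently, for a suitable real representative of $\hat\lambda_\ell$ modulo $2\pi$, $|R\hat\lambda_\ell-\phi_\ell'(t^*)|\le 2CR/n$. -/

import Mathlib

namespace SSO

open MeasureTheory ProbabilityTheory
open scoped ENNReal

noncomputable section

/-- The circle `ℝ / 2πℤ`; its norm `‖x‖` is the distance from `x` to the nearest multiple of `2π`. -/
abbrev Torus : Type := AddCircle (2 * Real.pi)

/-- A (smooth) low pass filter. -/
structure IsLowPassFilter (H : ℝ → ℝ) : Prop where
  smooth : ContDiff ℝ (⊤ : ℕ∞) H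
  mem_Icc : ∀ t, H t ∈ Set.Icc (0 : ℝ) 1
  even : ∀ t, H (-t) = H t
  eq_one : ∀ t, |t| ≤ 1 / 2 → H t = 1
  eq_zero : ∀ t, 1 ≤ |t| → H t = 0

/-- The normalizing constant `ħ_n = (∑_{|ℓ| < n} H(|ℓ| / n))⁻¹`. -/
def hbar (H : ℝ → ℝ) (n : ℕ) : ℝ :=
  (∑ ℓ ∈ Finset.Ioo (-(n : ℤ)) n, H (|(ℓ : ℝ)| / n))⁻¹

/-- The signal separation operator
`T_{n,R}(F)(t; x) = ħ_n ∑_{|ℓ| < n} H(|ℓ| / n) F(t - ℓ / R) exp(i ℓ x)`.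
On the circle of length `2π`, Mathlib's `fourier ℓ x` is `exp(i ℓ x)`. -/
def sepOp (H : ℝ → ℝ) (n : ℕ) (R : ℝ) (F : ℝ → ℂ) (t : ℝ) (x : Torus) : ℂ :=
  (hbar H n : ℂ) * ∑ ℓ ∈ Finset.Ioo (-(n : ℤ)) n,
    (H (|(ℓ : ℝ)| / n) : ℂ) * F (t - (ℓ : ℝ) / R) * fourier ℓ x

/-- The class `𝒢(ν)` of real valued random variables: mean zero and
`log 𝔼 exp(s X) ≤ (s ν)² / 2` for every real `s` (the expectation being finite). -/
structure IsSubGaussian {Ω : Type*} [MeasurableSpace Ω] (X : Ω → ℝ) (ν : ℝ) (P : Measure Ω) :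
    Prop where
  mean_zero : ∫ ω, X ω ∂P = 0
  integrable_exp : ∀ s : ℝ, Integrable (fun ω => Real.exp (s * X ω)) P
  log_mgf_le : ∀ s : ℝ, Real.log (∫ ω, Real.exp (s * X ω) ∂P) ≤ (s * ν) ^ 2 / 2

/-- A complex random variable is in `𝒢(ν)` if its real and imaginary parts are. -/
def IsComplexSubGaussian {Ω : Type*} [MeasurableSpace Ω] (X : Ω → ℂ) (ν : ℝ) (P : Measure Ω) :
    Prop :=
  IsSubGaussian (fun ω => (X ω).re) ν P ∧ IsSubGaussian (fun ω => (X ω).im) ν P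

/-- The constant `L = (14 √(2π) / 3) ‖H^{(S)}‖₁ / ‖H‖₁` of the localization estimate. -/
def locConst (H : ℝ → ℝ) (S : ℕ) : ℝ :=
  14 * Real.sqrt (2 * Real.pi) / 3 * ((∫ t, |iteratedDeriv S H t|) / ∫ t, |H t|)

section Signal

variable {K : ℕ}

/-- The component `f_j(s) = A_j(s) exp(i φ_j(s))`. -/
def component (A : Fin K → ℝ → ℂ) (φ : Fin K → ℝ → ℝ) (j : Fin K) (s : ℝ) : ℂ :=
  A j s * Complex.exp (Complex.I * (φ j s : ℂ))

/-- The total amplitude `𝐌 = ∑_j |A_j(t)|`. -/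
def totalAmp (A : Fin K → ℝ → ℂ) (t : ℝ) : ℝ := ∑ j, ‖A j t‖

/-- The minimal amplitude `𝔪 = min_j |f_j(t)|`. -/
def minAmp (A : Fin K → ℝ → ℂ) (φ : Fin K → ℝ → ℝ) (t : ℝ) : ℝ := ⨅ j, ‖component A φ j t‖

/-- The maximal instantaneous frequency `B = max_j |φ_j'(t)|`; `φ'` lists the derivatives. -/
def maxFreq (φ' : Fin K → ℝ → ℝ) (t : ℝ) : ℝ := ⨆ j, |φ' j t|

/-- The reduced frequency `λ_j = φ_j'(t) / R`, as a point of the circle. -/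
def redFreq (φ' : Fin K → ℝ → ℝ) (R t : ℝ) (j : Fin K) : Torus := ((φ' j t / R : ℝ) : Torus)

/-- The minimal separation `η*` of the reduced frequencies on the circle.  It is `∞` when there is
only one component, and `0` when two reduced frequencies coincide on the circle. -/
def minSep (φ' : Fin K → ℝ → ℝ) (R t : ℝ) : ℝ≥0∞ :=
  ⨅ (j : Fin K) (k : Fin K) (_ : j ≠ k), edist (redFreq φ' R t j) (redFreq φ' R t k)

/-- The constant `C = max(1, (16 𝐌 L / 𝔪)^{1/S})`. -/
def clusterConst (H : ℝ → ℝ) (S : ℕ) (A : Fin K → ℝ → ℂ) (φ : Fin K → ℝ → ℝ) (t : ℝ) : ℝ :=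
  max 1 ((16 * totalAmp A t * locConst H S / minAmp A φ t) ^ (1 / (S : ℝ)))

/-- The noisy signal `F(s) = ∑_j f_j(s) + ε(s)` for a realization `ε` of the noise. -/
def noisySignal (A : Fin K → ℝ → ℂ) (φ : Fin K → ℝ → ℝ) (ε : ℝ → ℂ) (s : ℝ) : ℂ :=
  (∑ j, component A φ j s) + ε s

end Signal

/-- The level set `{x ∈ 𝕋 : |T_{n,R}(F)(t; x)| ≥ θ}`. -/
def levelSet (H : ℝ → ℝ) (n : ℕ) (R : ℝ) (F : ℝ → ℂ) (t θ : ℝ) : Set Torus :=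
  {x | θ ≤ ‖sepOp H n R F t x‖}

end

end SSO

/-!
Applied to the signal with frozen amplitudes and instantaneous frequencies, the operator gives
`∑ j, f_j(t) Φ_n(x - λ_j)`, where `Φ_n` is the trigonometric kernel with coefficients
`ħ_n H(|ℓ| / n)`. Poisson summation and the smoothness of `H` give `‖Φ_n(x)‖ ≤ L / (n‖x‖)^S`, and
near the origin `‖Φ_n(x)‖ ≥ 1 - (n‖x‖)² / 2`. The error of freezing is at most `𝔪 / 8`. For the
noise, a union bound over `n²` equispaced points and the Lipschitz continuity of trigonometric
polynomials reduce the supremum over the circle to sub-Gaussian tails at finitely many points, and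
the supremum is at most `𝔪 / 16` with probability above `1 - δ`. Hence the level `3𝔪 / 4` is only
reached within `C / n` of some `λ_j`, and it is exceeded within `1 / (4n)` of each `λ_j`.
-/

namespace SSO

open MeasureTheory ProbabilityTheory
open scoped ENNReal NNReal

section Circle

theorem exists_coe_eq_and_abs_eq_norm {p : ℝ} (x : AddCircle p) :
    ∃ y : ℝ, (y : AddCircle p) = x ∧ |y| = ‖x‖ := by
  induction x using QuotientAddGroup.induction_on with
  | H x =>
    refine ⟨x - round (p⁻¹ * x) * p, ?_, (AddCircle.norm_eq p).symm⟩
    rw [← zsmul_eq_mul, AddCircle.coe_sub, AddCircle.coe_zsmul, AddCircle.coe_period, smul_zero,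
      sub_zero]

theorem exists_fin_dist_le {p : ℝ} (hp : 0 < p) {N : ℕ} (hN : N ≠ 0) (x : AddCircle p) :
    ∃ k : Fin N, dist x ((k * (p / N) : ℝ) : AddCircle p) ≤ p / N := by
  have : Fact (0 < p) := ⟨hp⟩
  have hstep : 0 < p / N := by positivity
  obtain ⟨hy₀, hyp⟩ := (AddCircle.equivIco p 0 x).2
  set y : ℝ := (AddCircle.equivIco p 0 x).1
  have hyx : (y : AddCircle p) = x := AddCircle.coe_equivIco
  have hlt : ⌊y / (p / N)⌋₊ < N := by
    rw [Nat.floor_lt (by positivity), div_lt_iff₀ hstep]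
    calc y < p := by simpa using hyp
      _ = N * (p / N) := by field_simp
  have hle : ⌊y / (p / N)⌋₊ * (p / N) ≤ y :=
    (le_div_iff₀ hstep).1 (Nat.floor_le (by positivity))
  have hge : y < (⌊y / (p / N)⌋₊ + 1) * (p / N) := (div_lt_iff₀ hstep).1 (Nat.lt_floor_add_one _)
  refine ⟨⟨_, hlt⟩, ?_⟩
  calc dist x ((⌊y / (p / N)⌋₊ * (p / N) : ℝ) : AddCircle p)
      = ‖((y - ⌊y / (p / N)⌋₊ * (p / N) : ℝ) : AddCircle p)‖ := by
        rw [AddCircle.coe_sub, hyx, dist_eq_norm]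
    _ ≤ |y - ⌊y / (p / N)⌋₊ * (p / N)| := QuotientAddGroup.norm_mk_le_norm
    _ ≤ p / N := by rw [abs_of_nonneg (by linarith)]; linarith

theorem Torus.norm_le_pi (x : Torus) : ‖x‖ ≤ Real.pi := by
  have h := AddCircle.norm_le_half_period (2 * Real.pi) (x := x) Real.two_pi_pos.ne'
  rwa [abs_of_pos Real.two_pi_pos, mul_div_cancel_left₀ _ two_ne_zero] at h

theorem fourier_coe_eq_exp (ℓ : ℤ) (x : ℝ) :
    fourier ℓ (x : Torus) = Complex.exp ((ℓ * x : ℝ) * Complex.I) := by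
  rw [fourier_coe_apply]
  congr 1
  have : (Real.pi : ℂ) ≠ 0 := by exact_mod_cast Real.pi_ne_zero
  push_cast
  field_simp

theorem fourier_apply_sub (ℓ : ℤ) (x y : Torus) :
    fourier ℓ (x - y) = fourier ℓ x * fourier (-ℓ) y := by
  rw [fourier_apply, zsmul_sub, sub_eq_add_neg, AddCircle.toCircle_add, Circle.coe_mul,
    fourier_apply, fourier_apply, neg_zsmul]

theorem norm_fourier_sub_fourier_le (ℓ : ℤ) (x y : Torus) :
    ‖fourier ℓ x - fourier ℓ y‖ ≤ |(ℓ : ℝ)| * dist x y := by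
  obtain ⟨r, hr, hr'⟩ := exists_coe_eq_and_abs_eq_norm (x - y)
  have hx : fourier ℓ x = fourier ℓ (r : Torus) * fourier ℓ y := by
    rw [hr, fourier_apply_sub, mul_assoc, ← fourier_add, neg_add_cancel, fourier_zero, mul_one]
  calc ‖fourier ℓ x - fourier ℓ y‖ = ‖(fourier ℓ (r : Torus) - 1) * fourier ℓ y‖ := by
        rw [hx, sub_one_mul]
    _ = ‖Complex.exp (Complex.I * (ℓ * r : ℝ)) - 1‖ := by
        rw [norm_mul, show ‖fourier ℓ y‖ = 1 from Circle.norm_coe _, mul_one, fourier_coe_eq_exp,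
          mul_comm Complex.I]
    _ ≤ |ℓ * r| := Real.norm_exp_I_mul_ofReal_sub_one_le
    _ = |(ℓ : ℝ)| * dist x y := by rw [abs_mul, hr', dist_eq_norm]

theorem exists_coe_eq_and_abs_mul_sub_le {p R θ ρ : ℝ} (hR : 0 < R) {x : AddCircle p}
    (hx : dist x ((θ / R : ℝ) : AddCircle p) ≤ ρ) :
    ∃ r : ℝ, (r : AddCircle p) = x ∧ |R * r - θ| ≤ R * ρ := by
  obtain ⟨y, hy, hy'⟩ := exists_coe_eq_and_abs_eq_norm (x - ((θ / R : ℝ) : AddCircle p))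
  refine ⟨y + θ / R, by rw [AddCircle.coe_add, hy, sub_add_cancel], ?_⟩
  have hRy : R * (y + θ / R) - θ = R * y := by field_simp; ring
  rw [hRy, abs_mul, abs_of_pos hR, hy', ← dist_eq_norm]
  exact mul_le_mul_of_nonneg_left hx hR.le

end Circle

section Poisson

open scoped FourierTransform ContDiff

theorem hasSum_one_div_int_sq :
    HasSum (fun k : ℤ => 1 / (k : ℝ) ^ 2) (Real.pi ^ 2 / 3) := by
  have h := hasSum_zeta_two
  have hneg : HasSum (fun k : ℕ => 1 / ((-((k : ℤ) + 1) : ℤ) : ℝ) ^ 2) (Real.pi ^ 2 / 6) := by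
    have hsucc : HasSum (fun k : ℕ => 1 / ((k + 1 : ℕ) : ℝ) ^ 2) (Real.pi ^ 2 / 6) := by
      simpa using (hasSum_nat_add_iff' 1).2 h
    exact hsucc.congr_fun fun k => by push_cast; rw [neg_sq]
  convert HasSum.of_nat_of_neg_add_one (f := fun k : ℤ => 1 / (k : ℝ) ^ 2) (by simpa using h) hneg
    using 1
  ring

theorem abs_mul_abs_intCast_le {x : ℝ} (hx : |x| ≤ Real.pi) {k : ℤ} (hk : k ≠ 0) :
    |x| * |(k : ℝ)| ≤ |2 * Real.pi * k - x| := by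
  have hk1 : (1 : ℝ) ≤ |(k : ℝ)| := by exact_mod_cast Int.one_le_abs hk
  have h := abs_sub_abs_le_abs_sub (2 * Real.pi * k) x
  rw [abs_mul, abs_of_pos Real.two_pi_pos] at h
  have hmul : 2 * Real.pi - |x| ≤ (2 * Real.pi - |x|) * |(k : ℝ)| :=
    le_mul_of_one_le_right (by linarith [Real.pi_pos]) hk1
  linarith

theorem pow_mul_norm_fourier_le {E : Type*} [NormedAddCommGroup E] [NormedSpace ℂ E] {f : ℝ → E}
    {S : ℕ} (hf : ContDiff ℝ S f) (hc : HasCompactSupport f) (ξ : ℝ) :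
    (2 * Real.pi * |ξ|) ^ S * ‖𝓕 f ξ‖ ≤ ∫ t, ‖iteratedDeriv S f t‖ := by
  have hint (m : ℕ) (hm : m ≤ (S : ℕ∞)) : Integrable (iteratedDeriv m f) := by
    refine (hf.continuous_iteratedDeriv m
      (by exact_mod_cast hm)).integrable_of_hasCompactSupport ?_
    exact (hc.iteratedFDeriv m).comp_left
      (g := fun L : ContinuousMultilinearMap ℝ (fun _ : Fin m => ℝ) E => L fun _ => 1) rfl
  calc (2 * Real.pi * |ξ|) ^ S * ‖𝓕 f ξ‖ = ‖𝓕 (iteratedDeriv S f) ξ‖ := by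
        rw [Real.fourier_iteratedDeriv (N := S) (by exact_mod_cast hf) hint le_rfl]
        simp [norm_smul, abs_of_pos Real.pi_pos]
    _ ≤ ∫ t, ‖iteratedDeriv S f t‖ := VectorFourier.norm_fourierIntegral_le_integral_norm ..

theorem fourier_exp_smul_comp_div {E : Type*} [NormedAddCommGroup E] [NormedSpace ℂ E]
    (f : ℝ → E) {a : ℝ} (ha : a ≠ 0) (x ξ : ℝ) :
    𝓕 (fun t : ℝ => Complex.exp ((t * x : ℝ) * Complex.I) • f (t / a)) ξ
      = |a| • 𝓕 f (a * (ξ - x / (2 * Real.pi))) := by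
  rw [Real.fourier_real_eq_integral_exp_smul, Real.fourier_real_eq_integral_exp_smul,
    ← Measure.integral_comp_div]
  refine integral_congr_ae (.of_forall fun t => ?_)
  simp only [smul_smul, ← Complex.exp_add, ← add_mul, ← Complex.ofReal_add]
  congr 4
  field_simp
  ring

theorem tsum_eq_tsum_fourier_of_hasCompactSupport {f : ℝ → ℂ} (hf : ContDiff ℝ ∞ f)
    (hc : HasCompactSupport f) : ∑' k : ℤ, f k = ∑' k : ℤ, 𝓕 f k := by
  have h := SchwartzMap.tsum_eq_tsum_fourier (hc.toSchwartzMap hf) 0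
  simp only [SchwartzMap.fourier_coe, zero_add, QuotientAddGroup.mk_zero, fourier_eval_zero,
    mul_one] at h
  exact h

theorem norm_fourier_exp_smul_comp_div_le {E : Type*} [NormedAddCommGroup E] [NormedSpace ℂ E]
    {f : ℝ → E} {S : ℕ} (hf : ContDiff ℝ S f) (hc : HasCompactSupport f) {a : ℝ} (ha : 0 < a)
    {x ξ d : ℝ} (hd : 0 < d) (hξ : d ≤ |2 * Real.pi * ξ - x|) :
    ‖𝓕 (fun t : ℝ => Complex.exp ((t * x : ℝ) * Complex.I) • f (t / a)) ξ‖
      ≤ a * ((∫ t, ‖iteratedDeriv S f t‖) / (a * d) ^ S) := by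
  have hfreq : 2 * Real.pi * |a * (ξ - x / (2 * Real.pi))| = a * |2 * Real.pi * ξ - x| := by
    rw [show 2 * Real.pi * ξ - x = 2 * Real.pi * (ξ - x / (2 * Real.pi)) by field_simp, abs_mul,
      abs_mul, abs_of_pos ha, abs_of_pos Real.two_pi_pos]
    ring
  rw [fourier_exp_smul_comp_div f ha.ne', norm_smul, norm_abs_eq_norm, Real.norm_of_nonneg ha.le]
  gcongr
  rw [le_div_iff₀' (by positivity)]
  refine le_trans ?_ (pow_mul_norm_fourier_le hf hc (a * (ξ - x / (2 * Real.pi))))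
  rw [hfreq]
  gcongr

theorem tsum_exp_mul_comp_div_eq_tsum_fourier {f : ℝ → ℂ} (hf : ContDiff ℝ ∞ f)
    (hc : HasCompactSupport f) {a : ℝ} (ha : a ≠ 0) (x : ℝ) :
    ∑' ℓ : ℤ, Complex.exp ((ℓ * x : ℝ) * Complex.I) * f (ℓ / a)
      = ∑' k : ℤ, 𝓕 (fun t : ℝ => Complex.exp ((t * x : ℝ) * Complex.I) • f (t / a)) k := by
  refine tsum_eq_tsum_fourier_of_hasCompactSupport
    (f := fun t : ℝ => Complex.exp ((t * x : ℝ) * Complex.I) • f (t / a)) ?_ ?_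
  · exact ((Complex.ofRealCLM.contDiff.comp (contDiff_id.mul contDiff_const)).mul
      contDiff_const).cexp.smul (hf.comp (contDiff_id.div_const a))
  · have hca : HasCompactSupport fun t => f (t / a) := by
      simpa only [div_eq_mul_inv, Function.comp_def, Homeomorph.coe_mulRight₀] using
        hc.comp_homeomorph (Homeomorph.mulRight₀ a⁻¹ (inv_ne_zero ha))
    exact hca.smul_left (f := fun t : ℝ => Complex.exp ((t * x : ℝ) * Complex.I))

/-- After Poisson summation, `S` integrations by parts bound the Fourier coefficient of frequency
`k` by a multiple of `|2πk - x|⁻ˢ`. -/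
theorem norm_tsum_exp_mul_comp_div_le {f : ℝ → ℂ} (hf : ContDiff ℝ ∞ f)
    (hc : HasCompactSupport f) {a : ℝ} (ha : 0 < a) {S : ℕ} (hS : 2 ≤ S) {x : ℝ} (hx : x ≠ 0)
    (hxπ : |x| ≤ Real.pi) :
    ‖∑' ℓ : ℤ, Complex.exp ((ℓ * x : ℝ) * Complex.I) * f (ℓ / a)‖
      ≤ a * ((∫ t, ‖iteratedDeriv S f t‖) / (a * |x|) ^ S) * (1 + Real.pi ^ 2 / 3) := by
  have hfS : ContDiff ℝ S f := hf.of_le (by exact_mod_cast le_top)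
  have hx₀ : 0 < |x| := abs_pos.2 hx
  have : 0 ≤ ∫ t, ‖iteratedDeriv S f t‖ := integral_nonneg fun t => norm_nonneg _
  -- `1 / k²` is `0` at `k = 0`, where the indicator takes over.
  have hweights : HasSum (fun k : ℤ => (if k = 0 then (1 : ℝ) else 0) + 1 / (k : ℝ) ^ 2)
      (1 + Real.pi ^ 2 / 3) := (hasSum_ite_eq 0 1).add hasSum_one_div_int_sq
  rw [tsum_exp_mul_comp_div_eq_tsum_fourier hf hc ha.ne']
  refine tsum_of_norm_bounded (hweights.mul_left _) fun k => ?_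
  rcases eq_or_ne k 0 with rfl | hk
  · simpa using norm_fourier_exp_smul_comp_div_le hfS hc ha (ξ := 0) hx₀ (by simp)
  · have hk₁ : (1 : ℝ) ≤ |(k : ℝ)| := by exact_mod_cast Int.one_le_abs hk
    refine (norm_fourier_exp_smul_comp_div_le hfS hc ha (by positivity)
      (abs_mul_abs_intCast_le hxπ hk)).trans ?_
    rw [if_neg hk, zero_add, ← mul_assoc, mul_pow, ← div_div, mul_assoc a, ← sq_abs (k : ℝ),
      div_eq_mul_one_div _ (|(k : ℝ)| ^ S)]
    gcongr

end Poisson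

section Filter

/-- The filter as a probability weight `w_ℓ = ħ_n H(|ℓ| / n)` on the integers `|ℓ| < n`, of which
`sepOp` is the weighted average. -/
noncomputable def filterWeight (H : ℝ → ℝ) (n : ℕ) (ℓ : ℤ) : ℝ := hbar H n * H (|(ℓ : ℝ)| / n)

/-- The kernel `Φ_n(x) = ∑_{|ℓ| < n} w_ℓ exp(i ℓ x)`: the value of `sepOp` at a pure exponential of
frequency `λ` is, up to a unimodular factor, `Φ_n(x - λ / R)`. -/
noncomputable def filterKernel (H : ℝ → ℝ) (n : ℕ) (x : Torus) : ℂ :=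
  ∑ ℓ ∈ Finset.Ioo (-(n : ℤ)) n, (filterWeight H n ℓ : ℂ) * fourier ℓ x

theorem sepOp_eq_sum (H : ℝ → ℝ) (n : ℕ) (R : ℝ) (F : ℝ → ℂ) (t : ℝ) (x : Torus) :
    sepOp H n R F t x = ∑ ℓ ∈ Finset.Ioo (-(n : ℤ)) n,
      (filterWeight H n ℓ : ℂ) * (F (t - ℓ / R) * fourier ℓ x) := by
  simp only [sepOp, filterWeight, Finset.mul_sum, Complex.ofReal_mul, mul_assoc]

theorem continuous_sepOp (H : ℝ → ℝ) (n : ℕ) (R : ℝ) (F : ℝ → ℂ) (t : ℝ) :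
    Continuous (sepOp H n R F t) := by
  unfold sepOp
  fun_prop

theorem mem_Ioo_neg_iff_abs_lt {n : ℕ} {ℓ : ℤ} :
    ℓ ∈ Finset.Ioo (-(n : ℤ)) n ↔ |(ℓ : ℝ)| < n := by
  rw [Finset.mem_Ioo, ← abs_lt, ← Int.cast_abs]
  exact_mod_cast Iff.rfl

theorem card_Ioo_neg {n : ℕ} (hn : 1 ≤ n) :
    ((Finset.Ioo (-(n : ℤ)) n).card : ℝ) = 2 * n - 1 := by
  have hcard : (Finset.Ioo (-(n : ℤ)) n).card + 1 = 2 * n := by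
    rw [Int.card_Ioo]
    omega
  rw [eq_sub_iff_add_eq]
  exact_mod_cast hcard

theorem sum_abs_Ioo_neg {n : ℕ} (hn : 1 ≤ n) :
    ∑ ℓ ∈ Finset.Ioo (-(n : ℤ)) n, |(ℓ : ℝ)| = n * (n - 1) := by
  obtain ⟨N, rfl⟩ := Nat.exists_eq_add_of_le' hn
  have hset : Finset.Ioo (-((N + 1 : ℕ) : ℤ)) ((N + 1 : ℕ) : ℤ) = Finset.Icc (-(N : ℤ)) N := by
    ext ℓ
    simp only [Finset.mem_Ioo, Finset.mem_Icc]
    omega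
  have hrange : (∑ m ∈ Finset.range (N + 1), (m : ℝ)) * 2 = (N + 1) * N := by
    have h := Finset.sum_range_id_mul_two (N + 1)
    rw [Nat.add_sub_cancel] at h
    rw [← Nat.cast_sum]
    exact_mod_cast h
  rw [hset, Finset.sum_Icc_of_even_eq_range (f := fun ℓ : ℤ => |(ℓ : ℝ)|)
    (fun ℓ => by simp)]
  simp only [Int.cast_natCast, Nat.abs_cast, Int.cast_zero, abs_zero, sub_zero, nsmul_eq_mul]
  push_cast
  linarith

namespace IsLowPassFilter

variable {H : ℝ → ℝ} (hH : IsLowPassFilter H)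
include hH

theorem nonneg (t : ℝ) : 0 ≤ H t := (hH.mem_Icc t).1

theorem le_one (t : ℝ) : H t ≤ 1 := (hH.mem_Icc t).2

theorem apply_abs (t : ℝ) : H |t| = H t := by
  rcases abs_choice t with h | h <;> rw [h]
  exact hH.even t

theorem apply_eq_zero_of_notMem_Icc {t : ℝ} (ht : t ∉ Set.Icc (-1 : ℝ) 1) : H t = 0 :=
  hH.eq_zero t (not_lt.1 fun h => ht (abs_le.1 h.le))

theorem hasCompactSupport : HasCompactSupport H :=
  HasCompactSupport.intro isCompact_Icc fun _ => hH.apply_eq_zero_of_notMem_Icc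

theorem integral_abs_le : ∫ t, |H t| ≤ 2 := by
  calc ∫ t, |H t| ≤ ∫ t, Set.indicator (Set.Icc (-1 : ℝ) 1) 1 t := by
        refine integral_mono_of_nonneg (.of_forall fun t => abs_nonneg _)
          ((integrable_indicator_iff measurableSet_Icc).2
            (integrableOn_const (by simp) (by simp))) (.of_forall fun t => ?_)
        by_cases ht : t ∈ Set.Icc (-1 : ℝ) 1
        · simpa [Set.indicator_of_mem ht, abs_of_nonneg (hH.nonneg t)] using hH.le_one t
        · simp [Set.indicator_of_notMem ht, hH.apply_eq_zero_of_notMem_Icc ht]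
    _ = 2 := by
        rw [integral_indicator_one measurableSet_Icc]
        norm_num [Measure.real]

theorem integral_abs_pos : 0 < ∫ t, |H t| := by
  refine hH.smooth.continuous.abs.integral_pos_of_hasCompactSupport_nonneg_nonzero (x := 0)
    (hH.hasCompactSupport.comp_left (g := abs) abs_zero) (fun t => abs_nonneg _) ?_
  simp [hH.eq_one 0 (by norm_num)]

theorem norm_iteratedDeriv_ofReal (S : ℕ) (t : ℝ) :
    ‖iteratedDeriv S (fun t => (H t : ℂ)) t‖ = |iteratedDeriv S H t| := by
  rw [← norm_iteratedFDeriv_eq_norm_iteratedDeriv, ← Real.norm_eq_abs,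
    ← norm_iteratedFDeriv_eq_norm_iteratedDeriv]
  exact Complex.ofRealLI.norm_iteratedFDeriv_comp_left
    (hH.smooth.contDiffAt.of_le (by exact_mod_cast le_top)) le_rfl

theorem hbar_nonneg (n : ℕ) : 0 ≤ hbar H n :=
  inv_nonneg.2 (Finset.sum_nonneg fun _ _ => hH.nonneg _)

theorem filterWeight_nonneg (n : ℕ) (ℓ : ℤ) : 0 ≤ filterWeight H n ℓ :=
  mul_nonneg (hH.hbar_nonneg n) (hH.nonneg _)

variable {n : ℕ} (hn : 1 ≤ n)
include hn

theorem le_sum : (n : ℝ) ≤ ∑ ℓ ∈ Finset.Ioo (-(n : ℤ)) n, H (|(ℓ : ℝ)| / n) := by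
  have hsub : Finset.Icc (-((n / 2 : ℕ) : ℤ)) ((n / 2 : ℕ) : ℤ) ⊆ Finset.Ioo (-(n : ℤ)) n := by
    intro ℓ
    simp only [Finset.mem_Icc, Finset.mem_Ioo]
    omega
  calc (n : ℝ) ≤ ∑ _ℓ ∈ Finset.Icc (-((n / 2 : ℕ) : ℤ)) ((n / 2 : ℕ) : ℤ), (1 : ℝ) := by
        rw [Finset.sum_const, nsmul_eq_mul, mul_one, Int.card_Icc]
        exact_mod_cast (by omega)
    _ = ∑ ℓ ∈ Finset.Icc (-((n / 2 : ℕ) : ℤ)) ((n / 2 : ℕ) : ℤ), H (|(ℓ : ℝ)| / n) := by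
        refine Finset.sum_congr rfl fun ℓ hℓ => (hH.eq_one _ ?_).symm
        have hℓ_half : |ℓ| ≤ ((n / 2 : ℕ) : ℤ) := abs_le.2 (Finset.mem_Icc.1 hℓ)
        have hℓ_two : 2 * |ℓ| ≤ n := by omega
        have hℓ_real : 2 * |(ℓ : ℝ)| ≤ n := by exact_mod_cast hℓ_two
        rw [abs_of_nonneg (by positivity)]
        exact div_le_of_le_mul₀ (by positivity) (by norm_num) (by linarith)
    _ ≤ _ := Finset.sum_le_sum_of_subset_of_nonneg hsub fun ℓ _ _ => hH.nonneg _

theorem hbar_le : hbar H n ≤ 1 / n := by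
  rw [one_div]
  exact inv_anti₀ (by exact_mod_cast hn) (hH.le_sum hn)

theorem filterWeight_le (ℓ : ℤ) : filterWeight H n ℓ ≤ 1 / n :=
  (mul_le_of_le_one_right (hH.hbar_nonneg n) (hH.le_one _)).trans (hH.hbar_le hn)

theorem sum_filterWeight : ∑ ℓ ∈ Finset.Ioo (-(n : ℤ)) n, filterWeight H n ℓ = 1 := by
  simp only [filterWeight, ← Finset.mul_sum]
  exact inv_mul_cancel₀ (lt_of_lt_of_le (by exact_mod_cast hn) (hH.le_sum hn)).ne'

/-- `H = 1` wherever `|ℓ| / n < 1 / 2`, so passing from `H` to the constant weight `1` can only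
increase the sum of `|ℓ| / n - 1 / 2`, and for the constant weight this sum is `-1 / 2`. -/
theorem sum_filterWeight_mul_abs_le :
    ∑ ℓ ∈ Finset.Ioo (-(n : ℤ)) n, filterWeight H n ℓ * (|(ℓ : ℝ)| / n) ≤ 1 / 2 := by
  have hn₀ : (n : ℝ) ≠ 0 := by positivity
  have hle : ∑ ℓ ∈ Finset.Ioo (-(n : ℤ)) n, H (|(ℓ : ℝ)| / n) * (|(ℓ : ℝ)| / n - 1 / 2) ≤ 0 := by
    calc ∑ ℓ ∈ Finset.Ioo (-(n : ℤ)) n, H (|(ℓ : ℝ)| / n) * (|(ℓ : ℝ)| / n - 1 / 2)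
        ≤ ∑ ℓ ∈ Finset.Ioo (-(n : ℤ)) n, (|(ℓ : ℝ)| / n - 1 / 2) := by
          refine Finset.sum_le_sum fun ℓ _ => ?_
          rcases le_total (|(ℓ : ℝ)| / n) (1 / 2) with h | h
          · rw [hH.eq_one _ (by rwa [abs_of_nonneg (by positivity)]), one_mul]
          · exact mul_le_of_le_one_left (by linarith) (hH.le_one _)
      _ = -1 / 2 := by
          rw [Finset.sum_sub_distrib, ← Finset.sum_div, Finset.sum_const, nsmul_eq_mul,
            card_Ioo_neg hn, sum_abs_Ioo_neg hn]
          field_simp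
          ring
      _ ≤ 0 := by norm_num
  calc ∑ ℓ ∈ Finset.Ioo (-(n : ℤ)) n, filterWeight H n ℓ * (|(ℓ : ℝ)| / n)
      = hbar H n * ∑ ℓ ∈ Finset.Ioo (-(n : ℤ)) n, H (|(ℓ : ℝ)| / n) * (|(ℓ : ℝ)| / n - 1 / 2)
          + (∑ ℓ ∈ Finset.Ioo (-(n : ℤ)) n, filterWeight H n ℓ) * (1 / 2) := by
        rw [Finset.mul_sum, Finset.sum_mul, ← Finset.sum_add_distrib]
        refine Finset.sum_congr rfl fun ℓ _ => ?_
        rw [filterWeight]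
        ring
    _ ≤ 1 / 2 := by
        rw [hH.sum_filterWeight hn, one_mul]
        linarith [mul_nonpos_of_nonneg_of_nonpos (hH.hbar_nonneg n) hle]

theorem norm_sum_filterWeight_mul_le {z : ℤ → ℂ} {D : ℝ} (hD : 0 ≤ D)
    (hz : ∀ ℓ ∈ Finset.Ioo (-(n : ℤ)) n, ‖z ℓ‖ ≤ D * (|(ℓ : ℝ)| / n)) :
    ‖∑ ℓ ∈ Finset.Ioo (-(n : ℤ)) n, (filterWeight H n ℓ : ℂ) * z ℓ‖ ≤ D / 2 := by
  calc ‖∑ ℓ ∈ Finset.Ioo (-(n : ℤ)) n, (filterWeight H n ℓ : ℂ) * z ℓ‖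
      ≤ ∑ ℓ ∈ Finset.Ioo (-(n : ℤ)) n, D * (filterWeight H n ℓ * (|(ℓ : ℝ)| / n)) := by
        refine norm_sum_le_of_le _ fun ℓ hℓ => ?_
        rw [norm_mul, Complex.norm_of_nonneg (hH.filterWeight_nonneg n ℓ), mul_left_comm D]
        exact mul_le_mul_of_nonneg_left (hz ℓ hℓ) (hH.filterWeight_nonneg n ℓ)
    _ ≤ D * (1 / 2) := by
        rw [← Finset.mul_sum]
        exact mul_le_mul_of_nonneg_left (hH.sum_filterWeight_mul_abs_le hn) hD
    _ = D / 2 := by ring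

theorem norm_sepOp_le {F : ℝ → ℂ} {R t D : ℝ} (hD : 0 ≤ D)
    (hF : ∀ ℓ ∈ Finset.Ioo (-(n : ℤ)) n, ‖F (t - ℓ / R)‖ ≤ D * (|(ℓ : ℝ)| / n)) (x : Torus) :
    ‖sepOp H n R F t x‖ ≤ D / 2 := by
  rw [sepOp_eq_sum]
  refine hH.norm_sum_filterWeight_mul_le hn hD fun ℓ hℓ => ?_
  rw [norm_mul, show ‖fourier ℓ x‖ = 1 from Circle.norm_coe _, mul_one]
  exact hF ℓ hℓ

theorem filterKernel_coe_eq_tsum (x : ℝ) :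
    filterKernel H n x = hbar H n *
      ∑' ℓ : ℤ, Complex.exp ((ℓ * x : ℝ) * Complex.I) * (H (ℓ / n) : ℂ) := by
  have hn₀ : (0 : ℝ) < n := by exact_mod_cast hn
  rw [tsum_eq_sum (s := Finset.Ioo (-(n : ℤ)) n), Finset.mul_sum, filterKernel]
  · refine Finset.sum_congr rfl fun ℓ _ => ?_
    rw [filterWeight, fourier_coe_eq_exp, ← hH.apply_abs ((ℓ : ℝ) / n), abs_div, Nat.abs_cast]
    push_cast
    ring
  · intro ℓ hℓ
    rw [mem_Ioo_neg_iff_abs_lt, not_lt] at hℓ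
    rw [hH.eq_zero _ (by rwa [abs_div, Nat.abs_cast, one_le_div hn₀]), Complex.ofReal_zero,
      mul_zero]

theorem norm_filterKernel_le {S : ℕ} (hS : 2 ≤ S) {x : Torus} (hx : x ≠ 0) :
    ‖filterKernel H n x‖ ≤ locConst H S / (n * ‖x‖) ^ S := by
  have hn₀ : (0 : ℝ) < n := by exact_mod_cast hn
  obtain ⟨y, rfl, hy⟩ := exists_coe_eq_and_abs_eq_norm x
  have hy₀ : y ≠ 0 := by rintro rfl; exact hx rfl
  have hsum := norm_tsum_exp_mul_comp_div_le (f := fun t => (H t : ℂ))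
    (Complex.ofRealCLM.contDiff.comp hH.smooth)
    (hH.hasCompactSupport.comp_left (g := fun r : ℝ => (r : ℂ)) Complex.ofReal_zero) hn₀ hS hy₀
    (hy ▸ Torus.norm_le_pi _)
  simp only [hH.norm_iteratedDeriv_ofReal, hy] at hsum
  set J := ∫ t, |iteratedDeriv S H t| with hJ
  have : 0 ≤ J := integral_nonneg fun t => abs_nonneg _
  set I := ∫ t, |H t| with hI
  have hI₀ : 0 < I := hH.integral_abs_pos
  have hconst : 1 + Real.pi ^ 2 / 3 ≤ 14 * Real.sqrt (2 * Real.pi) / 3 / I := by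
    have hsqrt : 5 / 2 ≤ Real.sqrt (2 * Real.pi) :=
      Real.le_sqrt_of_sq_le (by linarith [Real.pi_gt_d2])
    rw [le_div_iff₀ hI₀]
    calc (1 + Real.pi ^ 2 / 3) * I ≤ (1 + 3.15 ^ 2 / 3) * 2 := by
          gcongr
          exacts [Real.pi_lt_d2.le, hH.integral_abs_le]
      _ ≤ 14 * Real.sqrt (2 * Real.pi) / 3 := by linarith
  calc ‖filterKernel H n y‖
      ≤ 1 / n * (n * (J / (n * ‖(y : Torus)‖) ^ S) * (1 + Real.pi ^ 2 / 3)) := by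
        rw [hH.filterKernel_coe_eq_tsum hn, norm_mul,
          Complex.norm_of_nonneg (hH.hbar_nonneg n)]
        exact mul_le_mul (hH.hbar_le hn) hsum (norm_nonneg _) (by positivity)
    _ = (1 + Real.pi ^ 2 / 3) * J / (n * ‖(y : Torus)‖) ^ S := by field_simp
    _ ≤ 14 * Real.sqrt (2 * Real.pi) / 3 / I * J / (n * ‖(y : Torus)‖) ^ S := by gcongr
    _ = locConst H S / (n * ‖(y : Torus)‖) ^ S := by
        rw [locConst, ← hJ, ← hI, div_mul_eq_mul_div _ I, mul_div_assoc _ J]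

theorem one_sub_sq_div_two_le_norm_filterKernel (x : Torus) :
    1 - (n * ‖x‖) ^ 2 / 2 ≤ ‖filterKernel H n x‖ := by
  obtain ⟨y, rfl, hy⟩ := exists_coe_eq_and_abs_eq_norm x
  calc 1 - (n * ‖(y : Torus)‖) ^ 2 / 2
      = ∑ ℓ ∈ Finset.Ioo (-(n : ℤ)) n,
          filterWeight H n ℓ * (1 - (n * ‖(y : Torus)‖) ^ 2 / 2) := by
        rw [← Finset.sum_mul, hH.sum_filterWeight hn, one_mul]
    _ ≤ ∑ ℓ ∈ Finset.Ioo (-(n : ℤ)) n, filterWeight H n ℓ * Real.cos (ℓ * y) := by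
        refine Finset.sum_le_sum fun ℓ hℓ =>
          mul_le_mul_of_nonneg_left ?_ (hH.filterWeight_nonneg n ℓ)
        refine le_trans ?_ Real.one_sub_sq_div_two_le_cos
        rw [← sq_abs (ℓ * y), abs_mul, hy]
        gcongr
        exact (mem_Ioo_neg_iff_abs_lt.1 hℓ).le
    _ = (filterKernel H n y).re := by
        simp only [filterKernel, Complex.re_sum, Complex.re_ofReal_mul, fourier_coe_eq_exp,
          Complex.exp_ofReal_mul_I_re]
    _ ≤ ‖filterKernel H n y‖ := Complex.re_le_norm _

end IsLowPassFilter

theorem locConst_nonneg (H : ℝ → ℝ) (S : ℕ) : 0 ≤ locConst H S :=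
  mul_nonneg (by positivity)
    (div_nonneg (integral_nonneg fun _ => abs_nonneg _) (integral_nonneg fun _ => abs_nonneg _))

end Filter

section Linearization

theorem norm_exp_I_mul_sub_exp_I_mul_le (a b : ℝ) :
    ‖Complex.exp (Complex.I * a) - Complex.exp (Complex.I * b)‖ ≤ |a - b| := by
  have hfactor : Complex.exp (Complex.I * a) - Complex.exp (Complex.I * b)
      = (Complex.exp (Complex.I * (a - b : ℝ)) - 1) * Complex.exp (Complex.I * b) := by
    rw [sub_one_mul, ← Complex.exp_add, ← mul_add, ← Complex.ofReal_add, sub_add_cancel]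
  rw [hfactor, norm_mul, Complex.norm_exp_I_mul_ofReal, mul_one]
  exact Real.norm_exp_I_mul_ofReal_sub_one_le

theorem abs_sub_linearization_le {ψ ψ' : ℝ → ℝ} {t Δ α u : ℝ} (hα : 0 ≤ α)
    (hψ : ∀ s ∈ Set.Icc (t - Δ) (t + Δ), HasDerivWithinAt ψ (ψ' s) (Set.Icc (t - Δ) (t + Δ)) s)
    (hψ' : ∀ u : ℝ, |u| ≤ Δ → |ψ' (t + u) - ψ' t| ≤ α * |u| * |ψ' t|) (hu : |u| ≤ Δ) :
    |ψ (t + u) - (ψ t + u * ψ' t)| ≤ α * |u| * |ψ' t| * |u| := by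
  have hsub : Set.uIcc t (t + u) ⊆ Set.Icc (t - Δ) (t + Δ) := by
    obtain ⟨hu₁, hu₂⟩ := abs_le.1 hu
    have : 0 ≤ Δ := (abs_nonneg u).trans hu
    exact Set.uIcc_subset_Icc ⟨by linarith, by linarith⟩ ⟨by linarith, by linarith⟩
  have hderiv : ∀ s ∈ Set.uIcc t (t + u), HasDerivWithinAt (fun s => ψ s - s * ψ' t)
      (ψ' s - 1 * ψ' t) (Set.uIcc t (t + u)) s := fun s hs =>
    ((hψ s (hsub hs)).mono hsub).sub ((hasDerivWithinAt_id s _).mul_const _)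
  have hbound : ∀ s ∈ Set.uIcc t (t + u), ‖ψ' s - 1 * ψ' t‖ ≤ α * |u| * |ψ' t| := by
    intro s hs
    have hsu : |s - t| ≤ |u| := by simpa using Set.abs_sub_left_of_mem_uIcc hs
    calc ‖ψ' s - 1 * ψ' t‖ ≤ α * |s - t| * |ψ' t| := by
          simpa only [one_mul, Real.norm_eq_abs, add_sub_cancel] using hψ' (s - t) (hsu.trans hu)
      _ ≤ α * |u| * |ψ' t| := by gcongr
  have hmvt := (convex_uIcc t (t + u)).norm_image_sub_le_of_norm_hasDerivWithin_le hderiv hbound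
    Set.left_mem_uIcc Set.right_mem_uIcc
  rw [add_sub_cancel_left, Real.norm_eq_abs, Real.norm_eq_abs] at hmvt
  convert hmvt using 2
  ring

theorem norm_mul_exp_sub_linearization_le {a : ℝ → ℂ} {ψ ψ' : ℝ → ℝ} {t Δ α u : ℝ} (hα : 0 ≤ α)
    (hψ : ∀ s ∈ Set.Icc (t - Δ) (t + Δ), HasDerivWithinAt ψ (ψ' s) (Set.Icc (t - Δ) (t + Δ)) s)
    (ha : ∀ u : ℝ, |u| ≤ Δ → ‖a (t + u) - a t‖ ≤ α * |u| * ‖a t‖)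
    (hψ' : ∀ u : ℝ, |u| ≤ Δ → |ψ' (t + u) - ψ' t| ≤ α * |u| * |ψ' t|) (hu : |u| ≤ Δ) :
    ‖a (t + u) * Complex.exp (Complex.I * ψ (t + u))
        - a t * Complex.exp (Complex.I * ψ t) * Complex.exp (Complex.I * (u * ψ' t : ℝ))‖
      ≤ ‖a t‖ * (α * |u| * (1 + |ψ' t| * |u|)) := by
  have hsplit : a (t + u) * Complex.exp (Complex.I * ψ (t + u))
        - a t * Complex.exp (Complex.I * ψ t) * Complex.exp (Complex.I * (u * ψ' t : ℝ))
      = (a (t + u) - a t) * Complex.exp (Complex.I * ψ (t + u))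
        + a t * (Complex.exp (Complex.I * ψ (t + u))
          - Complex.exp (Complex.I * (ψ t + u * ψ' t : ℝ))) := by
    rw [Complex.ofReal_add (ψ t), mul_add Complex.I, Complex.exp_add]
    ring
  calc _ ≤ ‖a (t + u) - a t‖ * ‖Complex.exp (Complex.I * ψ (t + u))‖
        + ‖a t‖ * ‖Complex.exp (Complex.I * ψ (t + u))
          - Complex.exp (Complex.I * (ψ t + u * ψ' t : ℝ))‖ := by
        rw [hsplit, ← norm_mul, ← norm_mul]
        exact norm_add_le _ _
    _ ≤ α * |u| * ‖a t‖ * 1 + ‖a t‖ * (α * |u| * |ψ' t| * |u|) := by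
        gcongr
        · exact ha u hu
        · exact (Complex.norm_exp_I_mul_ofReal _).le
        · exact (norm_exp_I_mul_sub_exp_I_mul_le _ _).trans
            (abs_sub_linearization_le hα hψ hψ' hu)
    _ = ‖a t‖ * (α * |u| * (1 + |ψ' t| * |u|)) := by ring

variable {K : ℕ}

/-- The signal `s ↦ ∑_j f_j(t) exp(i (s - t) φ_j'(t))` obtained by freezing the amplitudes and the
instantaneous frequencies of the components at time `t`. -/
noncomputable def linearizedSignal (A : Fin K → ℝ → ℂ) (φ φ' : Fin K → ℝ → ℝ) (t s : ℝ) : ℂ :=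
  ∑ j, component A φ j t * Complex.exp (Complex.I * ((s - t) * φ' j t : ℝ))

theorem norm_component (A : Fin K → ℝ → ℂ) (φ : Fin K → ℝ → ℝ) (j : Fin K) (s : ℝ) :
    ‖component A φ j s‖ = ‖A j s‖ := by
  rw [component, norm_mul, Complex.norm_exp_I_mul_ofReal, mul_one]

theorem abs_le_maxFreq (φ' : Fin K → ℝ → ℝ) (t : ℝ) (j : Fin K) : |φ' j t| ≤ maxFreq φ' t :=
  le_ciSup (f := fun j => |φ' j t|) (Set.finite_range _).bddAbove j

theorem maxFreq_nonneg (φ' : Fin K → ℝ → ℝ) (t : ℝ) : 0 ≤ maxFreq φ' t :=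
  Real.iSup_nonneg fun _ => abs_nonneg _

theorem minAmp_le_norm_component (A : Fin K → ℝ → ℂ) (φ : Fin K → ℝ → ℝ) (t : ℝ) (j : Fin K) :
    minAmp A φ t ≤ ‖component A φ j t‖ :=
  ciInf_le (f := fun j => ‖component A φ j t‖) (Set.finite_range _).bddBelow j

theorem totalAmp_nonneg (A : Fin K → ℝ → ℂ) (t : ℝ) : 0 ≤ totalAmp A t :=
  Finset.sum_nonneg fun _ _ => norm_nonneg _

theorem sepOp_sub (H : ℝ → ℝ) (n : ℕ) (R : ℝ) (F G : ℝ → ℂ) (t : ℝ) (x : Torus) :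
    sepOp H n R (F - G) t x = sepOp H n R F t x - sepOp H n R G t x := by
  simp only [sepOp_eq_sum, Pi.sub_apply, sub_mul, mul_sub, Finset.sum_sub_distrib]

theorem sepOp_linearizedSignal (H : ℝ → ℝ) (n : ℕ) (R : ℝ) (A : Fin K → ℝ → ℂ)
    (φ φ' : Fin K → ℝ → ℝ) (t : ℝ) (x : Torus) :
    sepOp H n R (linearizedSignal A φ φ' t) t x
      = ∑ j, component A φ j t * filterKernel H n (x - redFreq φ' R t j) := by
  have hexp (ℓ : ℤ) (j : Fin K) :
      Complex.exp (Complex.I * ((t - ℓ / R - t) * φ' j t : ℝ))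
        = fourier (-ℓ) (redFreq φ' R t j) := by
    rw [redFreq, fourier_coe_eq_exp, mul_comm]
    congr 3
    push_cast
    ring
  simp only [sepOp_eq_sum, linearizedSignal, filterKernel, fourier_apply_sub, hexp, Finset.mul_sum,
    Finset.sum_mul]
  rw [Finset.sum_comm]
  refine Finset.sum_congr rfl fun j _ => Finset.sum_congr rfl fun ℓ _ => ?_
  ring

variable {A : Fin K → ℝ → ℂ} {φ φ' : Fin K → ℝ → ℝ} {t Δ α : ℝ} (hα : 0 ≤ α)
  (hd : ∀ j, ∀ s ∈ Set.Icc (t - Δ) (t + Δ),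
    HasDerivWithinAt (φ j) (φ' j s) (Set.Icc (t - Δ) (t + Δ)) s)
  (hA : ∀ j, ∀ u : ℝ, |u| ≤ Δ → ‖A j (t + u) - A j t‖ ≤ α * |u| * ‖A j t‖)
  (hφ : ∀ j, ∀ u : ℝ, |u| ≤ Δ → |φ' j (t + u) - φ' j t| ≤ α * |u| * |φ' j t|)
include hα hd hA hφ

theorem norm_sum_component_sub_linearizedSignal_le {u : ℝ} (hu : |u| ≤ Δ) :
    ‖(∑ j, component A φ j (t + u)) - linearizedSignal A φ φ' t (t + u)‖
      ≤ α * totalAmp A t * (maxFreq φ' t * Δ + 1) * |u| := by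
  have hB := maxFreq_nonneg φ' t
  rw [linearizedSignal, ← Finset.sum_sub_distrib, add_sub_cancel_left]
  calc _ ≤ ∑ j, ‖A j t‖ * (α * |u| * (1 + maxFreq φ' t * Δ)) := by
        refine norm_sum_le_of_le _ fun j _ =>
          (norm_mul_exp_sub_linearization_le hα (hd j) (hA j) (hφ j) hu).trans ?_
        have := abs_le_maxFreq φ' t j
        gcongr
    _ = α * totalAmp A t * (maxFreq φ' t * Δ + 1) * |u| := by
        rw [← Finset.sum_mul, ← totalAmp]
        ring

theorem IsLowPassFilter.norm_sepOp_noisySignal_sub_le {H : ℝ → ℝ} (hH : IsLowPassFilter H) {n : ℕ}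
    (hn : 1 ≤ n) {R : ℝ} (hR : 0 < R) (hnR : (n : ℝ) ≤ R * Δ) (e : ℝ → ℂ) (x : Torus) :
    ‖sepOp H n R (noisySignal A φ e) t x
        - ∑ j, component A φ j t * filterKernel H n (x - redFreq φ' R t j) - sepOp H n R e t x‖
      ≤ α * totalAmp A t * (maxFreq φ' t * Δ + 1) * Δ / 2 := by
  have hn₀ : (0 : ℝ) < n := by exact_mod_cast hn
  have hΔ : 0 < Δ := pos_of_mul_pos_right (hn₀.trans_le hnR) hR.le
  have hB := maxFreq_nonneg φ' t
  have hM := totalAmp_nonneg A t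
  rw [← sepOp_linearizedSignal, ← sepOp_sub, ← sepOp_sub]
  refine hH.norm_sepOp_le hn (by positivity) (fun ℓ hℓ => ?_) x
  have hu : |-((ℓ : ℝ) / R)| ≤ Δ * (|(ℓ : ℝ)| / n) := by
    rw [abs_neg, abs_div, abs_of_pos hR, mul_div_assoc', div_le_div_iff₀ hR hn₀]
    nlinarith [abs_nonneg (ℓ : ℝ)]
  have huΔ : |-((ℓ : ℝ) / R)| ≤ Δ := hu.trans <|
    mul_le_of_le_one_right hΔ.le ((div_le_one hn₀).2 (mem_Ioo_neg_iff_abs_lt.1 hℓ).le)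
  have herror := norm_sum_component_sub_linearizedSignal_le hα hd hA hφ huΔ
  rw [← sub_eq_add_neg] at herror
  calc ‖(noisySignal A φ e - linearizedSignal A φ φ' t - e) (t - ℓ / R)‖
      ≤ α * totalAmp A t * (maxFreq φ' t * Δ + 1) * |-((ℓ : ℝ) / R)| := by
        rwa [Pi.sub_apply, Pi.sub_apply, noisySignal, sub_right_comm, add_sub_cancel_right]
    _ ≤ α * totalAmp A t * (maxFreq φ' t * Δ + 1) * (Δ * (|(ℓ : ℝ)| / n)) := by gcongr
    _ = α * totalAmp A t * (maxFreq φ' t * Δ + 1) * Δ * (|(ℓ : ℝ)| / n) := by ring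

end Linearization

section Noise

variable {Ω : Type*} [MeasurableSpace Ω] {P : Measure Ω}

/-- A complex random variable whose real and imaginary parts are sub-Gaussian with variance proxy
`c`. Unlike the scale `ν` in `𝒢(ν)`, the proxy is additive over sums of independent variables. -/
structure HasComplexSubgaussianMGF (Z : Ω → ℂ) (c : ℝ≥0) (P : Measure Ω) : Prop where
  re : HasSubgaussianMGF (fun ω => (Z ω).re) c P
  im : HasSubgaussianMGF (fun ω => (Z ω).im) c P

theorem IsSubGaussian.hasSubgaussianMGF [NeZero P] {X : Ω → ℝ} {ν : ℝ}
    (h : IsSubGaussian X ν P) : HasSubgaussianMGF X (ν ^ 2).toNNReal P where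
  integrable_exp_mul := h.integrable_exp
  mgf_le s := by
    rw [Real.coe_toNNReal _ (sq_nonneg ν), ← Real.log_le_iff_le_exp
      (mgf_pos' NeZero.out (h.integrable_exp s)), mul_comm (ν ^ 2), ← mul_pow]
    exact h.log_mgf_le s

theorem IsComplexSubGaussian.hasComplexSubgaussianMGF [NeZero P] {Z : Ω → ℂ} {ν : ℝ}
    (h : IsComplexSubGaussian Z ν P) : HasComplexSubgaussianMGF Z (ν ^ 2).toNNReal P :=
  ⟨h.1.hasSubgaussianMGF, h.2.hasSubgaussianMGF⟩

theorem hasSubgaussianMGF_mono {X : Ω → ℝ} {c d : ℝ≥0} (h : HasSubgaussianMGF X c P)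
    (hcd : c ≤ d) : HasSubgaussianMGF X d P where
  integrable_exp_mul := h.integrable_exp_mul
  mgf_le s := (h.mgf_le s).trans <| by gcongr

theorem hasSubgaussianMGF_linear_combination {X Y : Ω → ℝ} {c : ℝ≥0}
    (hX : HasSubgaussianMGF X c P) (hY : HasSubgaussianMGF Y c P) (a b : ℝ) :
    HasSubgaussianMGF (fun ω => a * X ω + b * Y ω) (2 * (a ^ 2 + b ^ 2).toNNReal * c) P := by
  refine hasSubgaussianMGF_mono ((hX.const_mul a).add (hY.const_mul b)) ?_
  calc _ ≤ 2 * (NNReal.sqrt (.mk (a ^ 2) (sq_nonneg a) * c) ^ 2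
          + NNReal.sqrt (.mk (b ^ 2) (sq_nonneg b) * c) ^ 2) := add_sq_le
    _ = 2 * (a ^ 2 + b ^ 2).toNNReal * c := by
        rw [NNReal.sq_sqrt, NNReal.sq_sqrt, Real.toNNReal_add (sq_nonneg a) (sq_nonneg b),
          Real.toNNReal_of_nonneg (sq_nonneg a), Real.toNNReal_of_nonneg (sq_nonneg b)]
        ring

theorem measureReal_lt_abs_le [IsFiniteMeasure P] {X : Ω → ℝ} {c : ℝ≥0}
    (h : HasSubgaussianMGF X c P) {q : ℝ} (hq : 0 ≤ q) :
    P.real {ω | √(2 * c * q) < |X ω|} ≤ 2 * Real.exp (-q) := by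
  rcases eq_or_ne c 0 with rfl | hc
  · have hnull : P {ω | √(2 * (0 : ℝ≥0) * q) < |X ω|} = 0 := by
      refine measure_mono_null (fun ω hω => ?_) (ae_iff.1 h.ae_eq_zero_of_hasSubgaussianMGF_zero)
      simpa using hω
    rw [measureReal_def, hnull, ENNReal.toReal_zero]
    positivity
  · have hexp : Real.exp (-√(2 * c * q) ^ 2 / (2 * c)) = Real.exp (-q) := by
      rw [Real.sq_sqrt (by positivity), neg_div, mul_div_cancel_left₀ q (by positivity)]
    calc P.real {ω | √(2 * c * q) < |X ω|}
        ≤ P.real ({ω | √(2 * c * q) ≤ X ω} ∪ {ω | √(2 * c * q) ≤ (-X) ω}) :=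
          measureReal_mono fun ω hω => by
            simp only [Set.mem_ofPred_eq, Set.mem_union] at hω ⊢
            exact le_abs.1 hω.le
      _ ≤ P.real {ω | √(2 * c * q) ≤ X ω} + P.real {ω | √(2 * c * q) ≤ (-X) ω} :=
          measureReal_union_le _ _
      _ ≤ 2 * Real.exp (-q) := by
          rw [two_mul (Real.exp _), ← hexp]
          exact add_le_add (h.measure_ge_le (Real.sqrt_nonneg _))
            (h.neg.measure_ge_le (Real.sqrt_nonneg _))

namespace HasComplexSubgaussianMGF

theorem const_mul {Z : Ω → ℂ} {c : ℝ≥0} (h : HasComplexSubgaussianMGF Z c P) (a : ℂ) :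
    HasComplexSubgaussianMGF (fun ω => a * Z ω) (2 * ‖a‖₊ ^ 2 * c) P := by
  have hnorm : ‖a‖₊ ^ 2 = (a.re ^ 2 + a.im ^ 2).toNNReal := by
    rw [← norm_toNNReal, ← Real.toNNReal_pow (norm_nonneg a), Complex.sq_norm,
      Complex.normSq_apply, sq, sq]
  constructor
  · simpa only [hnorm, Complex.mul_re, neg_sq, neg_mul, ← sub_eq_add_neg]
      using hasSubgaussianMGF_linear_combination h.re h.im a.re (-a.im)
  · simpa only [hnorm, Complex.mul_im]
      using hasSubgaussianMGF_linear_combination h.im h.re a.re a.im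

theorem sum_of_iIndepFun {ι : Type*} {Z : ι → Ω → ℂ} (hind : iIndepFun Z P) {c : ι → ℝ≥0}
    {s : Finset ι} (h : ∀ i ∈ s, HasComplexSubgaussianMGF (Z i) (c i) P) :
    HasComplexSubgaussianMGF (fun ω => ∑ i ∈ s, Z i ω) (∑ i ∈ s, c i) P := by
  constructor
  · simpa only [Complex.re_sum, Function.comp_apply] using HasSubgaussianMGF.sum_of_iIndepFun
      (hind.comp (fun _ => Complex.re) fun _ => Complex.measurable_re) fun i hi => (h i hi).re
  · simpa only [Complex.im_sum, Function.comp_apply] using HasSubgaussianMGF.sum_of_iIndepFun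
      (hind.comp (fun _ => Complex.im) fun _ => Complex.measurable_im) fun i hi => (h i hi).im

theorem mono {Z : Ω → ℂ} {c d : ℝ≥0} (h : HasComplexSubgaussianMGF Z c P) (hcd : c ≤ d) :
    HasComplexSubgaussianMGF Z d P :=
  ⟨hasSubgaussianMGF_mono h.re hcd, hasSubgaussianMGF_mono h.im hcd⟩

theorem measureReal_lt_norm_le [IsFiniteMeasure P] {Z : Ω → ℂ} {c : ℝ≥0}
    (h : HasComplexSubgaussianMGF Z c P) {q : ℝ} (hq : 0 ≤ q) :
    P.real {ω | 2 * √(c * q) < ‖Z ω‖} ≤ 4 * Real.exp (-q) := by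
  have hsub : {ω | 2 * √(c * q) < ‖Z ω‖}
      ⊆ {ω | √(2 * c * q) < |(Z ω).re|} ∪ {ω | √(2 * c * q) < |(Z ω).im|} := by
    intro ω hω
    contrapose! hω
    simp only [Set.mem_union, Set.mem_ofPred_eq, not_or, not_lt] at hω ⊢
    refine (sq_le_sq₀ (norm_nonneg _) (by positivity)).1 ?_
    calc ‖Z ω‖ ^ 2 = |(Z ω).re| ^ 2 + |(Z ω).im| ^ 2 := by
          rw [Complex.sq_norm, Complex.normSq_apply, sq_abs, sq_abs, sq, sq]
      _ ≤ √(2 * c * q) ^ 2 + √(2 * c * q) ^ 2 := by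
          gcongr
          exacts [hω.1, hω.2]
      _ = (2 * √(c * q)) ^ 2 := by
          rw [mul_pow, Real.sq_sqrt (by positivity), Real.sq_sqrt (by positivity)]
          ring
  calc P.real {ω | 2 * √(c * q) < ‖Z ω‖}
      ≤ P.real {ω | √(2 * c * q) < |(Z ω).re|} + P.real {ω | √(2 * c * q) < |(Z ω).im|} :=
        (measureReal_mono hsub).trans (measureReal_union_le _ _)
    _ ≤ 2 * Real.exp (-q) + 2 * Real.exp (-q) :=
        add_le_add (measureReal_lt_abs_le h.re hq) (measureReal_lt_abs_le h.im hq)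
    _ = 4 * Real.exp (-q) := by ring

theorem measureReal_exists_lt_norm_le [IsFiniteMeasure P] {ι : Type*} [Fintype ι]
    {Z : ι → Ω → ℂ} {c : ℝ≥0} (h : ∀ i, HasComplexSubgaussianMGF (Z i) c P) {q : ℝ}
    (hq : 0 ≤ q) :
    P.real {ω | ∃ i, 2 * √(c * q) < ‖Z i ω‖} ≤ Fintype.card ι * (4 * Real.exp (-q)) := by
  rw [Set.ofPred_exists]
  calc P.real (⋃ i, {ω | 2 * √(c * q) < ‖Z i ω‖})
      ≤ ∑ i, P.real {ω | 2 * √(c * q) < ‖Z i ω‖} := measureReal_iUnion_fintype_le _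
    _ ≤ ∑ _i : ι, 4 * Real.exp (-q) :=
        Finset.sum_le_sum fun i _ => (h i).measureReal_lt_norm_le hq
    _ = Fintype.card ι * (4 * Real.exp (-q)) := by
        rw [Finset.sum_const, nsmul_eq_mul, Finset.card_univ]

end HasComplexSubgaussianMGF

namespace IsLowPassFilter

variable {H : ℝ → ℝ} (hH : IsLowPassFilter H) {n : ℕ} (hn : 1 ≤ n)

include hH hn

theorem hasComplexSubgaussianMGF_sepOp {ε : ℝ → Ω → ℂ} {R t : ℝ} {c : ℝ≥0}
    (hsub : ∀ ℓ ∈ Finset.Ioo (-(n : ℤ)) n, HasComplexSubgaussianMGF (ε (t - ℓ / R)) c P)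
    (hind : iIndepFun (fun ℓ : Finset.Ioo (-(n : ℤ)) n => ε (t - (ℓ : ℤ) / R)) P) (x : Torus) :
    HasComplexSubgaussianMGF (fun ω => sepOp H n R (fun s => ε s ω) t x) (4 * c / n) P := by
  have hnorm : ∀ ℓ : ℤ, ‖(filterWeight H n ℓ : ℂ) * fourier ℓ x‖₊ ≤ 1 / (n : ℝ≥0) := fun ℓ => by
    rw [← NNReal.coe_le_coe, coe_nnnorm, norm_mul, fourier_apply, Circle.norm_coe, mul_one,
      Complex.norm_real, Real.norm_of_nonneg (hH.filterWeight_nonneg n ℓ)]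
    exact_mod_cast hH.filterWeight_le hn ℓ
  have hproxy : ∑ _ℓ : Finset.Ioo (-(n : ℤ)) n, 2 * (1 / (n : ℝ≥0)) ^ 2 * c ≤ 4 * c / n := by
    have : (0 : ℝ≥0) < n := by exact_mod_cast hn
    have hcard : ((Finset.Ioo (-(n : ℤ)) n).card : ℝ≥0) ≤ 2 * n := by
      rw [← NNReal.coe_le_coe]
      push_cast
      linarith [card_Ioo_neg hn]
    rw [Finset.sum_const, nsmul_eq_mul, Finset.card_univ, Fintype.card_coe]
    calc _ ≤ 2 * (n : ℝ≥0) * (2 * (1 / (n : ℝ≥0)) ^ 2 * c) := by gcongr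
      _ = 4 * c / n := by
        field_simp
        ring
  have hterm : ∀ ℓ : Finset.Ioo (-(n : ℤ)) n, HasComplexSubgaussianMGF
      (fun ω => (filterWeight H n ℓ : ℂ) * fourier (ℓ : ℤ) x * ε (t - (ℓ : ℤ) / R) ω)
      (2 * (1 / (n : ℝ≥0)) ^ 2 * c) P := fun ℓ =>
    ((hsub ℓ ℓ.2).const_mul _).mono <| by
      gcongr
      exact hnorm ℓ
  have hsum := HasComplexSubgaussianMGF.sum_of_iIndepFun (s := Finset.univ)
    (hind.comp (fun ℓ z => (filterWeight H n ℓ : ℂ) * fourier (ℓ : ℤ) x * z)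
      fun _ => measurable_const_mul _) fun ℓ _ => hterm ℓ
  convert hsum.mono hproxy using 2 with ω
  rw [sepOp_eq_sum, ← Finset.sum_coe_sort]
  exact Finset.sum_congr rfl fun ℓ _ => by
    rw [Function.comp_apply]
    ring

theorem norm_sepOp_sub_sepOp_le {F : ℝ → ℂ} {R t M : ℝ} (hM : 0 ≤ M)
    (hF : ∀ ℓ ∈ Finset.Ioo (-(n : ℤ)) n, ‖F (t - ℓ / R)‖ ≤ M) (x y : Torus) :
    ‖sepOp H n R F t x - sepOp H n R F t y‖ ≤ M * n * dist x y / 2 := by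
  have : (0 : ℝ) < n := by exact_mod_cast hn
  rw [sepOp_eq_sum, sepOp_eq_sum, ← Finset.sum_sub_distrib]
  simp only [← mul_sub]
  refine hH.norm_sum_filterWeight_mul_le hn (by positivity) fun ℓ hℓ => ?_
  calc ‖F (t - ℓ / R) * (fourier ℓ x - fourier ℓ y)‖
      ≤ M * (|(ℓ : ℝ)| * dist x y) := by
        rw [norm_mul]
        gcongr
        exacts [hF ℓ hℓ, norm_fourier_sub_fourier_le ℓ x y]
    _ = M * n * dist x y * (|(ℓ : ℝ)| / n) := by field_simp

theorem norm_sepOp_le_of_forall_grid {F : ℝ → ℂ} {R t M a : ℝ} (hM : 0 ≤ M)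
    (hF : ∀ ℓ ∈ Finset.Ioo (-(n : ℤ)) n, ‖F (t - ℓ / R)‖ ≤ M)
    (hgrid : ∀ k : Fin (n ^ 2),
      ‖sepOp H n R F t ((k * (2 * Real.pi / (n ^ 2 : ℕ)) : ℝ) : Torus)‖ ≤ a) (x : Torus) :
    ‖sepOp H n R F t x‖ ≤ a + M * Real.pi / n := by
  have : (0 : ℝ) < n := by exact_mod_cast hn
  obtain ⟨k, hk⟩ := exists_fin_dist_le Real.two_pi_pos (pow_ne_zero 2 (by omega : n ≠ 0)) x
  refine (norm_le_norm_add_norm_sub' _ _).trans (add_le_add (hgrid k) ?_)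
  calc _ ≤ M * n * dist x _ / 2 := hH.norm_sepOp_sub_sepOp_le hn hM hF x _
    _ ≤ M * n * (2 * Real.pi / (n ^ 2 : ℕ)) / 2 := by gcongr
    _ = M * Real.pi / n := by
        push_cast
        field_simp

theorem measureReal_exists_lt_norm_sepOp_le [IsFiniteMeasure P] {ε : ℝ → Ω → ℂ} {R t : ℝ}
    {c : ℝ≥0}
    (hsub : ∀ ℓ ∈ Finset.Ioo (-(n : ℤ)) n, HasComplexSubgaussianMGF (ε (t - ℓ / R)) c P)
    (hind : iIndepFun (fun ℓ : Finset.Ioo (-(n : ℤ)) n => ε (t - (ℓ : ℤ) / R)) P) {q : ℝ}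
    (hq : 0 ≤ q) :
    P.real {ω | ∃ x, 11 * √(c * q / n) < ‖sepOp H n R (fun s => ε s ω) t x‖}
      ≤ 8 * n ^ 2 * Real.exp (-q) := by
  have hn1 : (1 : ℝ) ≤ n := by exact_mod_cast hn
  let grid (k : Fin (n ^ 2)) : Torus := ((k * (2 * Real.pi / (n ^ 2 : ℕ)) : ℝ) : Torus)
  have hsubset : {ω | ∃ x, 11 * √(c * q / n) < ‖sepOp H n R (fun s => ε s ω) t x‖}
      ⊆ {ω | ∃ ℓ : Finset.Ioo (-(n : ℤ)) n, 2 * √(c * q) < ‖ε (t - (ℓ : ℤ) / R) ω‖}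
        ∪ {ω | ∃ k, 2 * √((4 * c / n : ℝ≥0) * q)
            < ‖sepOp H n R (fun s => ε s ω) t (grid k)‖} := by
    intro ω hω
    contrapose! hω
    simp only [Set.mem_union, Set.mem_ofPred_eq, not_or, not_exists, not_lt] at hω ⊢
    intro x
    have hgrid : √((4 * c / n : ℝ≥0) * q) = 2 * √(c * q / n) := by
      rw [show ((4 * c / n : ℝ≥0) * q : ℝ) = 2 ^ 2 * (c * q / n) by push_cast; ring,
        Real.sqrt_mul (by norm_num), Real.sqrt_sq (by norm_num)]
    have hsample : √(c * q) / n ≤ √(c * q / n) := by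
      rw [Real.sqrt_div (by positivity)]
      gcongr
      exact Real.sqrt_le_iff.2 ⟨by positivity, by nlinarith⟩
    have hpi : 2 * Real.pi ≤ 7 := by linarith [Real.pi_lt_d2]
    calc _ ≤ 2 * √((4 * c / n : ℝ≥0) * q) + 2 * √(c * q) * Real.pi / n :=
          hH.norm_sepOp_le_of_forall_grid hn (by positivity) (fun ℓ hℓ => hω.1 ⟨ℓ, hℓ⟩) hω.2 x
      _ = 4 * √(c * q / n) + 2 * Real.pi * (√(c * q) / n) := by
          rw [hgrid]
          ring
      _ ≤ 4 * √(c * q / n) + 7 * √(c * q / n) := by gcongr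
      _ = 11 * √(c * q / n) := by ring
  calc _ ≤ _ := (measureReal_mono hsubset).trans (measureReal_union_le _ _)
    _ ≤ (2 * n - 1) * (4 * Real.exp (-q)) + n ^ 2 * (4 * Real.exp (-q)) := by
        refine add_le_add ?_ ?_
        · simpa only [Fintype.card_coe, card_Ioo_neg hn] using
            HasComplexSubgaussianMGF.measureReal_exists_lt_norm_le
              (fun ℓ : Finset.Ioo (-(n : ℤ)) n => hsub ℓ ℓ.2) hq
        · simpa only [Fintype.card_fin, Nat.cast_pow] using
            HasComplexSubgaussianMGF.measureReal_exists_lt_norm_le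
              (fun k => hH.hasComplexSubgaussianMGF_sepOp hn hsub hind (grid k)) hq
    _ ≤ 8 * n ^ 2 * Real.exp (-q) := by
        nlinarith [mul_nonneg (sq_nonneg ((n : ℝ) - 1)) (Real.exp_pos (-q)).le]

theorem exists_measurableSet_forall_norm_sepOp_le [IsProbabilityMeasure P] {ε : ℝ → Ω → ℂ}
    {R t V δ : ℝ} (hV : 0 ≤ V) (hδ : 0 < δ) (hδ1 : δ < 1)
    (hsub : ∀ ℓ ∈ Finset.Ioo (-(n : ℤ)) n, IsComplexSubGaussian (ε (t - ℓ / R)) V P)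
    (hind : iIndepFun (fun ℓ : Finset.Ioo (-(n : ℤ)) n => ε (t - (ℓ : ℤ) / R)) P) :
    ∃ E : Set Ω, MeasurableSet E ∧ 1 - δ < P.real E ∧ ∀ ω ∈ E, ∀ x,
      ‖sepOp H n R (fun s => ε s ω) t x‖ ≤ 16 * V * √(Real.log (3 * n / δ) / n) := by
  have hn1 : (1 : ℝ) ≤ n := by exact_mod_cast hn
  set q := Real.log (3 * n / δ) with hq_def
  have hq : 0 ≤ q := Real.log_nonneg <| by
    rw [one_le_div hδ]
    linarith
  set bad := {ω | ∃ x, 11 * √((V ^ 2).toNNReal * (2 * q) / n)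
    < ‖sepOp H n R (fun s => ε s ω) t x‖}
  have hlevel : 11 * √((V ^ 2).toNNReal * (2 * q) / n) ≤ 16 * V * √(q / n) := by
    rw [Real.coe_toNNReal _ (sq_nonneg V), show V ^ 2 * (2 * q) / n = V ^ 2 * 2 * (q / n) by ring,
      Real.sqrt_mul (by positivity), Real.sqrt_mul (sq_nonneg V), Real.sqrt_sq hV,
      show 11 * (V * √2 * √(q / n)) = 11 * √2 * V * √(q / n) by ring]
    have hsqrt : √2 ≤ 16 / 11 := Real.sqrt_le_iff.2 ⟨by norm_num, by norm_num⟩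
    gcongr
    linarith
  have hbad : P.real bad < δ := by
    calc P.real bad ≤ 8 * n ^ 2 * Real.exp (-(2 * q)) :=
          hH.measureReal_exists_lt_norm_sepOp_le hn
            (fun ℓ hℓ => (hsub ℓ hℓ).hasComplexSubgaussianMGF) hind (by positivity)
      _ = 8 / 9 * δ ^ 2 := by
          rw [Real.exp_neg, two_mul, Real.exp_add, hq_def, Real.exp_log (by positivity)]
          field_simp
          norm_num
      _ < δ := by nlinarith
  refine ⟨(toMeasurable P bad)ᶜ, (measurableSet_toMeasurable P bad).compl, ?_, fun ω hω x => ?_⟩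
  · rw [probReal_compl_eq_one_sub (measurableSet_toMeasurable P bad), measureReal_def,
      measure_toMeasurable, ← measureReal_def]
    linarith
  · by_contra! hlt
    exact hω (subset_toMeasurable P bad ⟨x, hlevel.trans_lt hlt⟩)

end IsLowPassFilter

end Noise

section Clustering

/-- The level set `{x | θ ≤ g x}` splits into clusters `G j` around the centers `p j`: the cluster
`G j` contains the closed ball of radius `r` and stays within distance `d` of its center, its
diameter is at most `d`, different clusters are `η / 2` apart, and `g` attains its maximum over
each of them. The separation `η` is extended-valued, so that it can be `∞` for a single center. -/
structure IsClustering {X ι : Type*} [PseudoMetricSpace X] (g : X → ℝ) (θ : ℝ) (p : ι → X)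
    (r d : ℝ) (η : ℝ≥0∞) (G : ι → Set X) : Prop where
  levelSet_eq : {x | θ ≤ g x} = ⋃ j, G j
  disjoint : ∀ j k, j ≠ k → Disjoint (G j) (G k)
  diam_le : ∀ j, Metric.diam (G j) ≤ d
  half_le_edist : ∀ j k, j ≠ k → ∀ x ∈ G j, ∀ y ∈ G k, η / 2 ≤ edist x y
  closedBall_subset : ∀ j, Metric.closedBall (p j) r ⊆ G j
  exists_isMaxOn : ∀ j, ∃ x ∈ G j, IsMaxOn g (G j) x
  dist_le : ∀ j, ∀ x ∈ G j, dist x (p j) ≤ d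

theorem half_le_edist_of_mem_closedBall {X : Type*} [PseudoMetricSpace X] {p q x y : X} {ρ : ℝ}
    {η : ℝ≥0∞} (hρη : ENNReal.ofReal (4 * ρ) ≤ η) (hη : η ≤ edist p q)
    (hx : x ∈ Metric.closedBall p ρ) (hy : y ∈ Metric.closedBall q ρ) : η / 2 ≤ edist x y := by
  have hdist : dist p q ≤ 2 * ρ + dist x y := by
    have htri := dist_triangle4 p x y q
    have hx' := Metric.mem_closedBall'.1 hx
    have hy' := Metric.mem_closedBall.1 hy
    linarith
  have hfar : 4 * ρ ≤ dist p q := by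
    rw [← ENNReal.ofReal_le_ofReal_iff dist_nonneg, ← edist_dist]
    exact hρη.trans hη
  calc η / 2 ≤ ENNReal.ofReal (dist p q) / 2 := by
        rw [← edist_dist]
        gcongr
    _ = ENNReal.ofReal (dist p q / 2) := by
        rw [ENNReal.ofReal_div_of_pos two_pos, ENNReal.ofReal_ofNat]
    _ ≤ edist x y := by
        rw [edist_dist]
        exact ENNReal.ofReal_le_ofReal (by linarith)

theorem isClustering_inter_closedBall {X ι : Type*} [PseudoMetricSpace X] [ProperSpace X]
    {g : X → ℝ} (hg : Continuous g) {θ : ℝ} {p : ι → X} {r ρ : ℝ} (hr : 0 ≤ r) (hρ : 0 < ρ)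
    (hrρ : r ≤ ρ) {η : ℝ≥0∞} (hρη : ENNReal.ofReal (4 * ρ) ≤ η)
    (hη : ∀ j k, j ≠ k → η ≤ edist (p j) (p k))
    (hloc : ∀ x, θ ≤ g x → ∃ j, dist x (p j) ≤ ρ)
    (hpeak : ∀ j x, dist x (p j) ≤ r → θ ≤ g x) :
    IsClustering g θ p r (2 * ρ) η fun j => {x | θ ≤ g x} ∩ Metric.closedBall (p j) ρ where
  levelSet_eq := by
    rw [← Set.inter_iUnion, Set.left_eq_inter]
    exact fun x hx => Set.mem_iUnion.2 (hloc x hx)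
  disjoint j k hjk := by
    refine Set.disjoint_left.2 fun x hx hy => ?_
    have hpos : 0 < η := (ENNReal.ofReal_pos.2 (by positivity)).trans_le hρη
    have hself := half_le_edist_of_mem_closedBall hρη (hη j k hjk) hx.2 hy.2
    rw [edist_self, nonpos_iff_eq_zero, ENNReal.div_eq_zero_iff] at hself
    exact hself.elim hpos.ne' ENNReal.ofNat_ne_top
  diam_le _ := (Metric.diam_mono Set.inter_subset_right Metric.isBounded_closedBall).trans
    (Metric.diam_closedBall hρ.le)
  half_le_edist j k hjk x hx y hy :=
    half_le_edist_of_mem_closedBall hρη (hη j k hjk) hx.2 hy.2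
  closedBall_subset j x hx := ⟨hpeak j x hx, Metric.closedBall_subset_closedBall hrρ hx⟩
  exists_isMaxOn j := by
    have hcompact : IsCompact ({x | θ ≤ g x} ∩ Metric.closedBall (p j) ρ) :=
      (isCompact_closedBall (p j) ρ).inter_left (isClosed_le continuous_const hg)
    have hcenter : p j ∈ {x | θ ≤ g x} ∩ Metric.closedBall (p j) ρ :=
      ⟨hpeak j (p j) (by rwa [dist_self]), Metric.mem_closedBall_self hρ.le⟩
    exact hcompact.exists_isMaxOn ⟨p j, hcenter⟩ hg.continuousOn
  dist_le j x hx := (Metric.mem_closedBall.1 hx.2).trans (by linarith)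

end Clustering

section ClusterConst

variable {K : ℕ} {A : Fin K → ℝ → ℂ} {φ φ' : Fin K → ℝ → ℝ} {t R : ℝ}

theorem one_le_clusterConst (H : ℝ → ℝ) (S : ℕ) (A : Fin K → ℝ → ℂ) (φ : Fin K → ℝ → ℝ) (t : ℝ) :
    1 ≤ clusterConst H S A φ t :=
  le_max_left _ _

theorem totalAmp_mul_locConst_le (H : ℝ → ℝ) {S : ℕ} (hS : S ≠ 0) (hm : 0 < minAmp A φ t) :
    totalAmp A t * locConst H S ≤ minAmp A φ t / 16 * clusterConst H S A φ t ^ S := by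
  have hM := totalAmp_nonneg A t
  have hL := locConst_nonneg H S
  set Q := 16 * totalAmp A t * locConst H S / minAmp A φ t with hQ
  calc totalAmp A t * locConst H S = minAmp A φ t / 16 * Q := by
        rw [hQ]
        field_simp
    _ = minAmp A φ t / 16 * (Q ^ (1 / (S : ℝ))) ^ S := by
        rw [one_div, Real.rpow_inv_natCast_pow (by positivity) hS]
    _ ≤ minAmp A φ t / 16 * clusterConst H S A φ t ^ S := by
        gcongr
        exact le_max_right _ _

theorem minSep_le_edist_redFreq (φ' : Fin K → ℝ → ℝ) (R t : ℝ) {j k : Fin K} (hjk : j ≠ k) :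
    minSep φ' R t ≤ edist (redFreq φ' R t j) (redFreq φ' R t k) :=
  iInf_le_of_le j (iInf_le_of_le k (iInf_le _ hjk))

end ClusterConst

section Localization

variable {H : ℝ → ℝ} (hH : IsLowPassFilter H) {n S : ℕ} (hn : 1 ≤ n) (hS : 2 ≤ S)

namespace IsLowPassFilter

include hH hn hS

theorem norm_sum_mul_filterKernel_le {ι : Type*} (a : ι → ℂ) (p : ι → Torus) {ρ : ℝ}
    (hρ : 0 < ρ) (s : Finset ι) {x : Torus} (hfar : ∀ j ∈ s, ρ ≤ n * dist x (p j)) :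
    ‖∑ j ∈ s, a j * filterKernel H n (x - p j)‖ ≤ (∑ j ∈ s, ‖a j‖) * (locConst H S / ρ ^ S) := by
  rw [Finset.sum_mul]
  refine norm_sum_le_of_le _ fun j hj => ?_
  rw [norm_mul]
  gcongr
  have hj' := hfar j hj
  rw [dist_eq_norm] at hj'
  have hne : x - p j ≠ 0 := fun h => by
    rw [h, norm_zero, mul_zero] at hj'
    exact hj'.not_gt hρ
  calc ‖filterKernel H n (x - p j)‖ ≤ locConst H S / (n * ‖x - p j‖) ^ S :=
        hH.norm_filterKernel_le hn hS hne
    _ ≤ locConst H S / ρ ^ S := by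
        have := locConst_nonneg H S
        gcongr

variable {K : ℕ} {A : Fin K → ℝ → ℂ} {φ φ' : Fin K → ℝ → ℝ} {t R : ℝ} (hm : 0 < minAmp A φ t)

include hm

theorem norm_sum_component_mul_filterKernel_le {c : ℝ} (hc : 0 < c) (s : Finset (Fin K))
    {x : Torus} (hfar : ∀ j ∈ s, c * clusterConst H S A φ t ≤ n * dist x (redFreq φ' R t j)) :
    ‖∑ j ∈ s, component A φ j t * filterKernel H n (x - redFreq φ' R t j)‖
      ≤ minAmp A φ t / 16 / c ^ S := by
  have hC : 0 < clusterConst H S A φ t := zero_lt_one.trans_le (one_le_clusterConst H S A φ t)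
  have hL := locConst_nonneg H S
  have hamp : ∑ j ∈ s, ‖component A φ j t‖ ≤ totalAmp A t := by
    simp only [norm_component]
    exact Finset.sum_le_univ_sum_of_nonneg fun j => norm_nonneg (A j t)
  calc _ ≤ (∑ j ∈ s, ‖component A φ j t‖) * (locConst H S / (c * clusterConst H S A φ t) ^ S) :=
        hH.norm_sum_mul_filterKernel_le hn hS _ _ (mul_pos hc hC) s hfar
    _ ≤ totalAmp A t * (locConst H S / (c * clusterConst H S A φ t) ^ S) := by gcongr
    _ = totalAmp A t * locConst H S / (c ^ S * clusterConst H S A φ t ^ S) := by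
        rw [mul_pow, mul_div_assoc]
    _ ≤ minAmp A φ t / 16 * clusterConst H S A φ t ^ S / (c ^ S * clusterConst H S A φ t ^ S) := by
        gcongr ?_ / _
        exact totalAmp_mul_locConst_le H (by omega) hm
    _ = minAmp A φ t / 16 / c ^ S := by field_simp

theorem exists_dist_redFreq_le {x : Torus}
    (hx : minAmp A φ t / 16
      < ‖∑ j, component A φ j t * filterKernel H n (x - redFreq φ' R t j)‖) :
    ∃ j, dist x (redFreq φ' R t j) ≤ clusterConst H S A φ t / n := by
  have hn₀ : (0 : ℝ) < n := by exact_mod_cast hn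
  contrapose! hx
  refine (hH.norm_sum_component_mul_filterKernel_le hn hS hm one_pos _ fun j _ => ?_).trans_eq
    (by rw [one_pow, div_one])
  rw [one_mul, ← div_le_iff₀' hn₀]
  exact (hx j).le

theorem le_norm_sum_component_mul_filterKernel
    (hsep : ∀ j k, j ≠ k →
      4 * clusterConst H S A φ t ≤ n * dist (redFreq φ' R t j) (redFreq φ' R t k))
    {j : Fin K} {x : Torus} (hx : n * dist x (redFreq φ' R t j) ≤ 1 / 4) :
    15 / 16 * minAmp A φ t
      ≤ ‖∑ k, component A φ k t * filterKernel H n (x - redFreq φ' R t k)‖ := by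
  set term : Fin K → ℂ := fun k => component A φ k t * filterKernel H n (x - redFreq φ' R t k)
  have hnear : 31 / 32 * minAmp A φ t ≤ ‖term j‖ := by
    rw [norm_mul, mul_comm]
    refine mul_le_mul (minAmp_le_norm_component A φ t j) ?_ (by norm_num) (norm_nonneg _)
    refine le_trans ?_ (hH.one_sub_sq_div_two_le_norm_filterKernel hn _)
    rw [← dist_eq_norm]
    nlinarith [show 0 ≤ n * dist x (redFreq φ' R t j) by positivity]
  have hothers : ‖∑ k ∈ Finset.univ.erase j, term k‖ ≤ minAmp A φ t / 64 := by
    calc _ ≤ minAmp A φ t / 16 / 2 ^ S := by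
          refine hH.norm_sum_component_mul_filterKernel_le hn hS hm two_pos _ fun k hk => ?_
          have htri := mul_le_mul_of_nonneg_left
            (dist_triangle_left (redFreq φ' R t k) (redFreq φ' R t j) x)
            (Nat.cast_nonneg (α := ℝ) n)
          linarith [hsep k j (Finset.ne_of_mem_erase hk), one_le_clusterConst H S A φ t]
      _ ≤ minAmp A φ t / 16 / 2 ^ 2 := by
          gcongr
          norm_num
      _ = minAmp A φ t / 64 := by ring
  rw [← Finset.add_sum_erase _ _ (Finset.mem_univ j)]
  linarith [norm_sub_le_norm_add (term j) (∑ k ∈ Finset.univ.erase j, term k)]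

theorem isClustering_sepOp {F : ℝ → ℂ}
    (hsep : ENNReal.ofReal (4 * clusterConst H S A φ t) / minSep φ' R t ≤ (n : ENNReal))
    (happrox : ∀ x, ‖sepOp H n R F t x
        - ∑ j, component A φ j t * filterKernel H n (x - redFreq φ' R t j)‖
      ≤ 3 * minAmp A φ t / 16) :
    ∃ G : Fin K → Set Torus, IsClustering (fun x => ‖sepOp H n R F t x‖) (3 * minAmp A φ t / 4)
      (redFreq φ' R t) (1 / (4 * n)) (2 * clusterConst H S A φ t / n) (minSep φ' R t) G := by
  have : Fact (0 < 2 * Real.pi) := ⟨Real.two_pi_pos⟩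
  have hn₀ : (0 : ℝ) < n := by exact_mod_cast hn
  have hC := one_le_clusterConst H S A φ t
  have hη : ENNReal.ofReal (4 * (clusterConst H S A φ t / n)) ≤ minSep φ' R t := by
    rw [← mul_div_assoc, ENNReal.ofReal_div_of_pos hn₀, ENNReal.ofReal_natCast]
    rw [ENNReal.div_le_iff_le_mul (.inr (ENNReal.natCast_ne_top n))
      (.inr (by exact_mod_cast hn₀.ne'))] at hsep
    exact ENNReal.div_le_of_le_mul' hsep
  have hdist : ∀ j k, j ≠ k →
      4 * clusterConst H S A φ t ≤ n * dist (redFreq φ' R t j) (redFreq φ' R t k) := by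
    intro j k hjk
    rw [← div_le_iff₀' hn₀, mul_div_assoc, ← ENNReal.ofReal_le_ofReal_iff dist_nonneg,
      ← edist_dist]
    exact hη.trans (minSep_le_edist_redFreq φ' R t hjk)
  rw [mul_div_assoc 2 (clusterConst H S A φ t)]
  refine ⟨_, isClustering_inter_closedBall (continuous_sepOp H n R F t).norm (by positivity)
    (by positivity) ?_ hη (fun j k => minSep_le_edist_redFreq φ' R t) ?_ ?_⟩
  · rw [div_le_div_iff₀ (by positivity) hn₀]
    nlinarith
  · refine fun x hx => hH.exists_dist_redFreq_le hn hS hm ?_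
    linarith [happrox x, norm_le_norm_add_norm_sub
      (∑ j, component A φ j t * filterKernel H n (x - redFreq φ' R t j)) (sepOp H n R F t x),
      norm_sub_rev (sepOp H n R F t x)
        (∑ j, component A φ j t * filterKernel H n (x - redFreq φ' R t j))]
  · intro j x hx
    have hpeak := hH.le_norm_sum_component_mul_filterKernel hn hS hm hdist (j := j) (x := x) <| by
      rw [le_div_iff₀ (by positivity)] at hx
      linarith
    linarith [happrox x, norm_le_norm_add_norm_sub (sepOp H n R F t x)
      (∑ j, component A φ j t * filterKernel H n (x - redFreq φ' R t j))]

end IsLowPassFilter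

end Localization

end SSO

open SSO in
theorem theorem4p3p1_general {H : ℝ → ℝ} (hH : IsLowPassFilter H) {S : ℕ} (hS : 2 ≤ S)
    {Ω : Type*} [MeasurableSpace Ω] {P : MeasureTheory.Measure Ω}
    [MeasureTheory.IsProbabilityMeasure P] {K : ℕ} {t α Δ R V δ : ℝ} (hα : 0 ≤ α) (hR : 0 < R)
    (hV : 0 ≤ V) (hδ : 0 < δ) (hδ1 : δ < 1) {n : ℕ} (hn : 1 ≤ n) (hnR : n ≤ R * Δ)
    {A : Fin K → ℝ → ℂ} {φ φ' : Fin K → ℝ → ℝ}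
    (hd : ∀ j, ∀ s ∈ Set.Icc (t - Δ) (t + Δ),
      HasDerivWithinAt (φ j) (φ' j s) (Set.Icc (t - Δ) (t + Δ)) s)
    (hm : 0 < minAmp A φ t)
    (hA : ∀ j, ∀ u : ℝ, |u| ≤ Δ → ‖A j (t + u) - A j t‖ ≤ α * |u| * ‖A j t‖)
    (hφ : ∀ j, ∀ u : ℝ, |u| ≤ Δ → |φ' j (t + u) - φ' j t| ≤ α * |u| * |φ' j t|)
    {ε : ℝ → Ω → ℂ}
    (hsub : ∀ ℓ : ℤ, |ℓ| < n → IsComplexSubGaussian (ε (t - ℓ / R)) V P)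
    (hind : ProbabilityTheory.iIndepFun
      (fun ℓ : {ℓ : ℤ // |ℓ| < (n : ℤ)} => ε (t - ((ℓ : ℤ) : ℝ) / R)) P)
    (hnoise : 16 * V * √(Real.log (3 * n / δ) / n) ≤ minAmp A φ t / 16)
    (hsep : ENNReal.ofReal (4 * clusterConst H S A φ t) / minSep φ' R t ≤ (n : ENNReal))
    (hslow : α * totalAmp A t * (maxFreq φ' t * Δ + 1) * Δ ≤ minAmp A φ t / 4) :
    ∃ E : Set Ω, MeasurableSet E ∧ 1 - δ < P.real E ∧ ∀ ω ∈ E, ∃ G : Fin K → Set Torus,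
      IsClustering (fun x => ‖sepOp H n R (noisySignal A φ fun s => ε s ω) t x‖)
        (3 * minAmp A φ t / 4) (redFreq φ' R t) (1 / (4 * n)) (2 * clusterConst H S A φ t / n)
        (minSep φ' R t) G := by
  have hmem : ∀ ℓ ∈ Finset.Ioo (-(n : ℤ)) n, |ℓ| < n := fun ℓ hℓ => abs_lt.2 (Finset.mem_Ioo.1 hℓ)
  let toAbs (ℓ : Finset.Ioo (-(n : ℤ)) n) : {ℓ : ℤ // |ℓ| < (n : ℤ)} := ⟨ℓ, hmem ℓ ℓ.2⟩
  have htoAbs : Function.Injective toAbs := fun ℓ k h => Subtype.ext (Subtype.mk.inj h)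
  obtain ⟨E, hE, hPE, hbound⟩ := hH.exists_measurableSet_forall_norm_sepOp_le hn hV hδ hδ1
    (fun ℓ hℓ => hsub ℓ (hmem ℓ hℓ)) (hind.precomp htoAbs)
  refine ⟨E, hE, hPE, fun ω hω => hH.isClustering_sepOp hn hS hm hsep fun x => ?_⟩
  set T := sepOp H n R (noisySignal A φ fun s => ε s ω) t x
  set N := sepOp H n R (fun s => ε s ω) t x
  have hlin : ‖T - ∑ j, component A φ j t * filterKernel H n (x - redFreq φ' R t j) - N‖
      ≤ α * totalAmp A t * (maxFreq φ' t * Δ + 1) * Δ / 2 :=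
    hH.norm_sepOp_noisySignal_sub_le hα hd hA hφ hn hR hnR (fun s => ε s ω) x
  linarith [hbound ω hω x,
    norm_le_norm_add_norm_sub'
      (T - ∑ j, component A φ j t * filterKernel H n (x - redFreq φ' R t j)) N]

theorem theorem4p3p1 (H : ℝ → ℝ) (hH : SSO.IsLowPassFilter H) :
    ∃ C₁ C₂ C₃ : ℝ, 1 ≤ C₁ ∧ 0 < C₂ ∧ 0 < C₃ ∧
      ∀ (S : ℕ) (_ : 2 ≤ S)
        (Ω : Type*) [MeasurableSpace Ω]
        (P : MeasureTheory.Measure Ω) [MeasureTheory.IsProbabilityMeasure P]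
        (K : ℕ) (_ : 1 ≤ K)
        (t α Δ R V δ : ℝ) (_ : 0 < α) (_ : 0 < Δ) (_ : 0 < R) (_ : 0 ≤ V) (_ : 0 < δ) (_ : δ < 1)
        (n : ℕ) (_ : n = ⌊R * Δ⌋₊)
        -- the components of the signal near `t`
        (A : Fin K → ℝ → ℂ) (φ φ' : Fin K → ℝ → ℝ)
        (_ : ∀ j, ContinuousOn (A j) (Set.Icc (t - Δ) (t + Δ)))
        (_ : ∀ j, ∀ s ∈ Set.Icc (t - Δ) (t + Δ),
          HasDerivWithinAt (φ j) (φ' j s) (Set.Icc (t - Δ) (t + Δ)) s)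
        (_ : ∀ j, ContinuousOn (φ' j) (Set.Icc (t - Δ) (t + Δ)))
        (_ : 0 < SSO.minAmp A φ t)
        -- slow variation
        (_ : ∀ j, ∀ u : ℝ, |u| ≤ Δ → ‖A j (t + u) - A j t‖ ≤ α * |u| * ‖A j t‖)
        (_ : ∀ j, ∀ u : ℝ, |u| ≤ Δ → |φ' j (t + u) - φ' j t| ≤ α * |u| * |φ' j t|)
        -- the noise, independent at the sampling points
        (ε : ℝ → Ω → ℂ) (_ : ∀ s, Measurable (ε s))
        (_ : ∀ s, SSO.IsComplexSubGaussian (ε s) V P)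
        (_ : ProbabilityTheory.iIndepFun
          (fun ℓ : {ℓ : ℤ // |ℓ| < (n : ℤ)} => ε (t - ((ℓ : ℤ) : ℝ) / R)) P)
        -- the conditions on `n` and `Δ`
        (_ : C₁ ≤ (n : ℝ))
        (_ : C₂ * V * Real.sqrt (Real.log (C₃ * n / δ) / n) ≤ SSO.minAmp A φ t / 16)
        (_ : ENNReal.ofReal (4 * SSO.clusterConst H S A φ t) / SSO.minSep φ' R t ≤ (n : ENNReal))
        (_ : α * SSO.totalAmp A t * (SSO.maxFreq φ' t * Δ + 1) * Δ ≤ SSO.minAmp A φ t / 4),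
        ∃ E : Set Ω, MeasurableSet E ∧ 1 - δ < P.real E ∧
          ∀ ω ∈ E,
            ∃ G : Fin K → Set SSO.Torus,
              -- disjoint union
              SSO.levelSet H n R (SSO.noisySignal A φ (fun s => ε s ω)) t
                  (3 * SSO.minAmp A φ t / 4) = (⋃ ℓ, G ℓ) ∧
              (∀ ℓ k, ℓ ≠ k → Disjoint (G ℓ) (G k)) ∧
              -- diameter
              (∀ ℓ, Metric.diam (G ℓ) ≤ 2 * SSO.clusterConst H S A φ t / n) ∧
              -- separation
              (∀ ℓ k, ℓ ≠ k → ∀ x ∈ G ℓ, ∀ y ∈ G k, SSO.minSep φ' R t / 2 ≤ edist x y) ∧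
              -- interval inclusion
              (∀ ℓ, Metric.closedBall (SSO.redFreq φ' R t ℓ) (1 / (4 * n)) ⊆ G ℓ) ∧
              -- a maximizer exists in each cluster
              (∀ ℓ, ∃ x ∈ G ℓ, IsMaxOn
                (fun y => ‖SSO.sepOp H n R (SSO.noisySignal A φ (fun s => ε s ω)) t y‖) (G ℓ) x) ∧
              -- and every maximizer estimates the frequency, also after multiplication by `R`
              (∀ ℓ, ∀ x ∈ G ℓ, IsMaxOn
                (fun y => ‖SSO.sepOp H n R (SSO.noisySignal A φ (fun s => ε s ω)) t y‖) (G ℓ) x →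
                dist x (SSO.redFreq φ' R t ℓ) ≤ 2 * SSO.clusterConst H S A φ t / n ∧
                ∃ r : ℝ, (r : SSO.Torus) = x ∧
                  |R * r - φ' ℓ t| ≤ R * (2 * SSO.clusterConst H S A φ t / n)) := by
  refine ⟨1, 16, 3, le_rfl, by norm_num, by norm_num, ?_⟩
  intro S hS Ω _ P _ K _ t α Δ R V δ hα hΔ hR hV hδ hδ1 n hn A φ φ' _ hd _ hm hA hφ ε _ hsub hind
    hn1 hnoise hsep hslow
  obtain ⟨E, hE, hPE, hG⟩ := theorem4p3p1_general hH hS hα.le hR hV hδ hδ1 (by exact_mod_cast hn1)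
    (hn ▸ Nat.floor_le (by positivity)) hd hm hA hφ (fun _ _ => hsub _) hind hnoise hsep hslow
  exact ⟨E, hE, hPE, fun ω hω => (hG ω hω).imp fun G h => ⟨h.levelSet_eq, h.disjoint, h.diam_le,
    h.half_le_edist, h.closedBall_subset, h.exists_isMaxOn, fun ℓ x hx _ =>
      ⟨h.dist_le ℓ x hx, SSO.exists_coe_eq_and_abs_mul_sub_le hR (h.dist_le ℓ x hx)⟩⟩⟩
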